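/- Let $D > 8\log 2$ be a real number. There is a constant $C = C(D) > 0$, depending only on $D$, such that the following holds for every positive integer $q$, every non-principal Dirichlet character $\chi$ modulo $q$ (primitive or not; such a character exists only if $q \ge 3$), and all real numbers $a, b$ with $0 \le a < b$. Let $L(s,\chi)$ denote the Dirichlet $L$-function of $\chi$, that is, the entire function that equals $\sum_{n\ge1}\chi(n)n^{-s}$ for $\Re(s) > 1$. (a) If $b \ge 2\pi$, then there exists a positive integer $$k \le C\, b^3 q \exp\Big(\frac{D\log(b^3 q)}{\log\log(b^3 q)}\Big)$$ for which $L\big(\tfrac12 + i(a+kb),\chi\big) \ne 0$. (b) If $0 < b \le 2\pi$, then there exists a positive integer $$k \le C\, b^{-1} q \exp\Big(\frac{D\log q}{\log\log q}\Big)$$ for which $L\big(\tfrac12 + i(a+kb),\chi\big) \ne 0$. -/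

import Mathlib

/-! The proof is a mollified first moment. Write `s_k = 1/2 + i(a + kb)` and suppose that `L(s_k, χ)
= 0` for all `1 ≤ k ≤ K`. On the critical line `L` is a Dirichlet polynomial of length `qM` with
error `O(√(q/M))` as soon as `M ≥ 2|s|` (`exists_norm_LFunction_sub_sum_le`), so at each `s_k` that
polynomial is small. Multiplied by the mollifier `∑_{m ≤ y} μ(m)χ(m)m^{-s}` it becomes `1 + ∑_{l >
y} c_l l^{-s}` with `|c_l| ≤ d(l)` (`exists_mollified_coeff`). Averaged over `k`, the term `1`
survives, and each `l^{-s_k}` gives a geometric sum that is large only when `b log l` is close to a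
multiple of `2π` (`sum_norm_sum_cpow_progression_le`).

Up to logarithms this yields `1 ≪ √(yq/M) + Δ b (1/√y + √(yqM)/(Kb))`, where `Δ` bounds the divisor
function and `M ≍ Kb`. The choices `y ≍ b²e²` and `K ≍ b³q e⁴` make the right side small once `e`
exceeds `Δ` by more than logarithms. The frequencies reach about `(b³q)^(2+o(1))`, so `Δ` is about
`exp(2 log 2 · x / log x)` with `x = log(b³q)`. Taking `e = exp((D/4) x / log x)` gives a
contradiction exactly when `D > 8 log 2`. A small step `b` is reduced to a step between 1 and 8 by
passing to a multiple of it. -/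

/-! ### Exponential quotients near 0, uniformly in the parameter -/

lemma exists_lipschitz_dslope_exp : ∃ L : ℝ, 0 ≤ L ∧
    (∀ w w' : ℂ, ‖w‖ ≤ 1 / 2 → ‖w'‖ ≤ 1 / 2 →
      ‖dslope Complex.exp 0 w - dslope Complex.exp 0 w'‖ ≤ L * ‖w - w'‖) := by
  have hd : Differentiable ℂ (dslope Complex.exp 0) := by
    rw [← differentiableOn_univ, Complex.differentiableOn_dslope Filter.univ_mem]
    exact Complex.differentiable_exp.differentiableOn
  have hc : Continuous (deriv (dslope Complex.exp 0)) :=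
    (hd.contDiff (n := 1)).continuous_deriv le_rfl
  obtain ⟨C, hC⟩ := (isCompact_closedBall (0 : ℂ) (1 / 2)).exists_bound_of_continuousOn
    hc.continuousOn
  have hC0 : 0 ≤ C := (norm_nonneg _).trans (hC 0 (by simp))
  refine ⟨C, hC0, fun w w' hw hw' => ?_⟩
  exact Convex.norm_image_sub_le_of_norm_deriv_le (𝕜 := ℂ) (s := Metric.closedBall 0 (1 / 2))
    (fun x _ => hd x) hC (convex_closedBall _ _) (by simpa using hw') (by simpa using hw)

lemma norm_dslope_exp_sub_one_le {w : ℂ} (hw : ‖w‖ ≤ 1 / 2) :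
    ‖dslope Complex.exp 0 w - 1‖ ≤ 1 / 2 := by
  rcases eq_or_ne w 0 with rfl | h
  · simp
  · rw [dslope_of_ne _ h, slope_def_field]
    have h1 := Complex.norm_exp_sub_one_sub_id_le (x := w) (by linarith)
    have h2 : (Complex.exp w - Complex.exp 0) / (w - 0) - 1 = (Complex.exp w - 1 - w) / w := by
      simp; field_simp
    rw [h2, norm_div, div_le_iff₀ (norm_pos_iff.2 h)]
    nlinarith [norm_nonneg w]

/-- The quotient `(e^{-ρη} - 1) / (e^{-η} - 1)`, continued by its value at `η = 0`. -/
noncomputable def expRatio (ρ : ℝ) (η : ℂ) : ℂ :=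
  ρ * dslope Complex.exp 0 (-(ρ * η)) / dslope Complex.exp 0 (-η)

lemma dslope_exp_mul (w : ℂ) : dslope Complex.exp 0 w * w = Complex.exp w - 1 := by
  have := sub_smul_dslope Complex.exp 0 w
  simp at this
  rw [← this, mul_comm]

lemma half_le_norm_dslope_exp {w : ℂ} (hw : ‖w‖ ≤ 1 / 2) :
    1 / 2 ≤ ‖dslope Complex.exp 0 w‖ := by
  have h := norm_dslope_exp_sub_one_le hw
  have h2 := norm_sub_norm_le (1 : ℂ) (1 - dslope Complex.exp 0 w)
  rw [norm_one, norm_sub_rev 1, sub_sub_cancel] at h2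
  linarith

lemma norm_dslope_exp_le {w : ℂ} (hw : ‖w‖ ≤ 1 / 2) :
    ‖dslope Complex.exp 0 w‖ ≤ 2 := by
  have h := norm_dslope_exp_sub_one_le hw
  have h2 := norm_sub_norm_le (dslope Complex.exp 0 w) 1
  rw [norm_one] at h2
  linarith

lemma expRatio_mul {ρ : ℝ} {η : ℂ} (hη : ‖η‖ ≤ 1 / 2) :
    (Complex.exp (-η) - 1) * expRatio ρ η = Complex.exp (-(ρ * η)) - 1 := by
  have h0 : dslope Complex.exp 0 (-η) ≠ 0 := by
    rw [← norm_pos_iff]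
    linarith [half_le_norm_dslope_exp (w := -η) (by simpa using hη)]
  rw [← dslope_exp_mul, ← dslope_exp_mul, expRatio]
  field_simp

lemma norm_ofReal_mul_le {ρ : ℝ} (h0 : 0 ≤ ρ) (h1 : ρ ≤ 1) {η : ℂ} : ‖(ρ : ℂ) * η‖ ≤ ‖η‖ := by
  rw [norm_mul, Complex.norm_real, Real.norm_of_nonneg h0]
  exact mul_le_of_le_one_left (norm_nonneg _) h1

lemma norm_expRatio_le {ρ : ℝ} (h0 : 0 ≤ ρ) (h1 : ρ ≤ 1) {η : ℂ} (hη : ‖η‖ ≤ 1 / 2) :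
    ‖expRatio ρ η‖ ≤ 4 := by
  have ha := norm_dslope_exp_le (w := -(ρ * η))
    (by rw [norm_neg]; exact (norm_ofReal_mul_le h0 h1).trans hη)
  have hb := half_le_norm_dslope_exp (w := -η) (by simpa using hη)
  rw [expRatio, norm_div, div_le_iff₀ (by linarith)]
  exact (norm_ofReal_mul_le h0 h1).trans (by linarith)

/-- Numerator and denominator are slopes of `exp`, Lipschitz on the disc, and the denominator stays
away from 0. Uniformity in `ρ` matters: `ρ = r/q` will run over all residues of all moduli. -/
lemma exists_lipschitz_expRatio : ∃ L : ℝ, 0 ≤ L ∧ ∀ ρ : ℝ, 0 ≤ ρ → ρ ≤ 1 → ∀ η η' : ℂ,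
    ‖η‖ ≤ 1 / 2 → ‖η'‖ ≤ 1 / 2 → ‖expRatio ρ η - expRatio ρ η'‖ ≤ L * ‖η - η'‖ := by
  obtain ⟨L, hL, h⟩ := exists_lipschitz_dslope_exp
  refine ⟨16 * L, by positivity, fun ρ h0 h1 η η' hη hη' => ?_⟩
  have hr := (norm_ofReal_mul_le h0 h1 (η := η)).trans hη
  have hr' := (norm_ofReal_mul_le h0 h1 (η := η')).trans hη'
  have e1 := h (-(ρ * η)) (-(ρ * η')) (by simpa using hr) (by simpa using hr')
  have e2 := h (-η') (-η) (by simpa using hη') (by simpa using hη)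
  have e3 : ‖-(ρ * η) - -(ρ * η')‖ ≤ ‖η - η'‖ := by
    rw [show -(ρ * η) - -(ρ * η') = -((ρ : ℂ) * (η - η')) by ring, norm_neg]
    exact norm_ofReal_mul_le h0 h1
  have e4 : ‖-η' - -η‖ = ‖η - η'‖ := by congr 1; ring
  have ha := norm_dslope_exp_le (w := -(ρ * η)) (by simpa using hr)
  have hb := half_le_norm_dslope_exp (w := -η) (by simpa using hη)
  have hb2 := norm_dslope_exp_le (w := -η) (by simpa using hη)
  have hb' := half_le_norm_dslope_exp (w := -η') (by simpa using hη')
  unfold expRatio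
  set A := dslope Complex.exp 0 (-(ρ * η))
  set A' := dslope Complex.exp 0 (-(ρ * η'))
  set B := dslope Complex.exp 0 (-η)
  set B' := dslope Complex.exp 0 (-η')
  have hB : B ≠ 0 := norm_pos_iff.1 (by linarith)
  have hB' : B' ≠ 0 := norm_pos_iff.1 (by linarith)
  have key : ρ * A / B - ρ * A' / B' = ρ * ((A * (B' - B) + B * (A - A')) / (B * B')) := by
    field_simp; ring
  rw [key]
  refine (norm_ofReal_mul_le h0 h1).trans ?_
  rw [norm_div, norm_mul, div_le_iff₀ (by positivity)]
  have n1 : ‖A * (B' - B) + B * (A - A')‖ ≤ 2 * (L * ‖η - η'‖) + 2 * (L * ‖η - η'‖) := by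
    refine (norm_add_le _ _).trans (add_le_add ?_ ?_)
    · rw [norm_mul]
      exact mul_le_mul ha (by rw [← e4]; exact e2) (norm_nonneg _) (by norm_num)
    · rw [norm_mul]
      exact mul_le_mul hb2 (e1.trans (mul_le_mul_of_nonneg_left e3 hL)) (norm_nonneg _)
        (by norm_num)
  have n2 : 1 / 4 ≤ ‖B‖ * ‖B'‖ := by nlinarith
  have n3 : 0 ≤ L * ‖η - η'‖ := by positivity
  nlinarith

lemma abs_log_one_add_sub_le {u : ℝ} (hu : 0 ≤ u) : |Real.log (1 + u) - u| ≤ u ^ 2 := by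
  have h1 := Real.log_le_sub_one_of_pos (x := 1 + u) (by linarith)
  have h2 := Real.one_sub_inv_le_log_of_pos (x := 1 + u) (by linarith)
  have h3 : u - u ^ 2 ≤ 1 - (1 + u)⁻¹ := by
    have : 1 - (1 + u)⁻¹ = u / (1 + u) := by field_simp; ring
    rw [this, le_div_iff₀ (by linarith)]
    nlinarith [pow_nonneg hu 3]
  rw [abs_le]; constructor <;> nlinarith

/-- `(m + ρ)^{-s} = m^{-s} (e^{-ρ s / m} + O(|s| / m ^ 2))`. -/
lemma norm_add_cpow_neg_sub_le {x ρ : ℝ} (hx : 1 ≤ x) (h0 : 0 ≤ ρ) (h1 : ρ ≤ 1) {s : ℂ}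
    (hs : 2 * ‖s‖ ≤ x) :
    ‖((x + ρ : ℝ) : ℂ) ^ (-s) - (x : ℂ) ^ (-s) * Complex.exp (-(ρ * (s / x)))‖ ≤
      ‖(x : ℂ) ^ (-s)‖ * (6 * ‖s‖ / x ^ 2) := by
  have hx0 : 0 < x := by linarith
  have hxc : (x : ℂ) ≠ 0 := by exact_mod_cast hx0.ne'
  set w : ℂ := -s * ((Real.log (1 + ρ / x) - ρ / x : ℝ) : ℂ) with hw
  have hdecomp : ((x + ρ : ℝ) : ℂ) ^ (-s) =
      (x : ℂ) ^ (-s) * Complex.exp (-(ρ * (s / x))) * Complex.exp w := by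
    have e : x + ρ = x * (1 + ρ / x) := by field_simp
    have hp : 0 < 1 + ρ / x := by positivity
    rw [e, Complex.ofReal_mul, Complex.mul_cpow_ofReal_nonneg hx0.le hp.le,
      Complex.cpow_def_of_ne_zero (x := ((1 + ρ / x : ℝ) : ℂ)) (by exact_mod_cast hp.ne'),
      ← Complex.ofReal_log hp.le, mul_assoc, ← Complex.exp_add]
    congr 2
    rw [hw]; push_cast; ring
  have hwn : ‖w‖ ≤ ‖s‖ / x ^ 2 := by
    rw [hw, norm_mul, norm_neg, Complex.norm_real, Real.norm_eq_abs, div_eq_mul_inv]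
    refine mul_le_mul_of_nonneg_left ((abs_log_one_add_sub_le (by positivity)).trans ?_)
      (norm_nonneg _)
    rw [mul_pow, inv_pow]
    exact mul_le_of_le_one_left (by positivity) (by nlinarith)
  have hw1 : ‖s‖ / x ^ 2 ≤ 1 := by
    rw [div_le_one (by positivity)]; nlinarith [norm_nonneg s]
  have he : ‖Complex.exp (-(ρ * (s / x)))‖ ≤ 3 := by
    refine (Complex.norm_exp_le_exp_norm _).trans ?_
    have : ‖-((ρ : ℂ) * (s / x))‖ ≤ 1 := by
      rw [norm_neg]
      refine (norm_ofReal_mul_le h0 h1).trans ?_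
      rw [norm_div, Complex.norm_real, Real.norm_of_nonneg hx0.le, div_le_one hx0]
      linarith [norm_nonneg s]
    exact (Real.exp_le_exp.2 this).trans (by linarith [Real.exp_one_lt_d9])
  rw [hdecomp, ← mul_sub_one, norm_mul, norm_mul, mul_assoc]
  refine mul_le_mul_of_nonneg_left ?_ (norm_nonneg _)
  have := Complex.norm_exp_sub_one_le (hwn.trans hw1)
  calc _ ≤ 3 * (2 * (‖s‖ / x ^ 2)) := by
        refine mul_le_mul he (this.trans (by linarith)) (norm_nonneg _) (by norm_num)
    _ = _ := by ring

/-! ### Truncating the Dirichlet series at a multiple of the modulus -/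

section
variable {q : ℕ} (χ : DirichletCharacter ℂ q)

/-- The sum of `χ(n) n^{-s}` over `q m ≤ n < q (m + 1)`. -/
noncomputable def charBlock (s : ℂ) (m : ℕ) : ℂ :=
  ∑ r ∈ Finset.range q, χ ((r : ℕ) : ZMod q) * ((q * m + r : ℕ) : ℂ) ^ (-s)

lemma sum_range_mul_eq {M : Type*} [AddCommMonoid M] (f : ℕ → M) (a b : ℕ) :
    ∑ n ∈ Finset.range (a * b), f n =
      ∑ i ∈ Finset.range b, ∑ r ∈ Finset.range a, f (a * i + r) := by
  induction b with
  | zero => simp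
  | succ b ih => rw [Finset.sum_range_succ, ← ih, Nat.mul_succ, Finset.sum_range_add]

lemma sum_range_charBlock (s : ℂ) (M : ℕ) :
    ∑ m ∈ Finset.range M, charBlock χ s m =
      ∑ n ∈ Finset.range (q * M), χ (n : ZMod q) * (n : ℂ) ^ (-s) := by
  rw [sum_range_mul_eq]
  refine Finset.sum_congr rfl fun m _ => Finset.sum_congr rfl fun r _ => ?_
  simp

/-- The character-weighted exponential sum over one period. -/
noncomputable def charExpSum (η : ℂ) : ℂ :=
  ∑ r ∈ Finset.range q, χ ((r : ℕ) : ZMod q) * Complex.exp (-(((r / q : ℝ) : ℂ) * η))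

/-- The quotient of `charExpSum χ η` by `e^{-η} - 1`. -/
noncomputable def charExpQuot (η : ℂ) : ℂ :=
  ∑ r ∈ Finset.range q, χ ((r : ℕ) : ZMod q) * expRatio (r / q : ℝ) η

lemma div_le_one_of_mem_range {r : ℕ} (hr : r ∈ Finset.range q) : (r / q : ℝ) ≤ 1 := by
  have : r < q := by simpa using hr
  exact div_le_one_of_le₀ (by exact_mod_cast this.le) (by positivity)

lemma norm_sum_char_mul_le (f : ℕ → ℂ) {B : ℝ} (h : ∀ r ∈ Finset.range q, ‖f r‖ ≤ B) :
    ‖∑ r ∈ Finset.range q, χ ((r : ℕ) : ZMod q) * f r‖ ≤ q * B := by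
  refine (norm_sum_le_of_le (f := fun r : ℕ => χ (r : ZMod q) * f r) _
    (n := fun _ => B) fun r hr => ?_).trans_eq (by simp)
  rw [norm_mul]
  exact (mul_le_of_le_one_left (norm_nonneg _) (DirichletCharacter.norm_le_one χ _)).trans (h r hr)

variable [NeZero q]

variable {χ}

lemma sum_range_char_eq_zero (hχ : χ ≠ 1) : ∑ r ∈ Finset.range q, χ ((r : ℕ) : ZMod q) = 0 := by
  rw [← MulChar.sum_eq_zero_of_ne_one hχ]
  refine Finset.sum_nbij' (fun r => (r : ZMod q)) ZMod.val ?_ ?_ ?_ ?_ ?_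
  · simp
  · intro a _; simpa using ZMod.val_lt a
  · intro a ha; exact ZMod.val_cast_of_lt (by simpa using ha)
  · simp
  · simp

/-- As `χ` sums to zero over a period, each exponential may be replaced by itself minus 1, which is
divisible by `e^{-η} - 1`. This factor is what later lets the blocks telescope. -/
lemma charExpQuot_mul (hχ : χ ≠ 1) {η : ℂ} (hη : ‖η‖ ≤ 1 / 2) :
    (Complex.exp (-η) - 1) * charExpQuot χ η = charExpSum χ η := by
  unfold charExpQuot charExpSum
  rw [Finset.mul_sum, ← sub_eq_zero, ← Finset.sum_sub_distrib, ← neg_eq_zero,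
    ← Finset.sum_neg_distrib, ← sum_range_char_eq_zero hχ]
  refine Finset.sum_congr rfl fun r _ => ?_
  rw [mul_left_comm, expRatio_mul hη]
  ring

lemma norm_charExpSum_le (hχ : χ ≠ 1) {η : ℂ} (hη : ‖η‖ ≤ 1 / 2) :
    ‖charExpSum χ η‖ ≤ q * (2 * ‖η‖) := by
  have : charExpSum χ η = ∑ r ∈ Finset.range q,
      χ ((r : ℕ) : ZMod q) * (Complex.exp (-(((r / q : ℝ) : ℂ) * η)) - 1) := by
    simp only [mul_sub, mul_one, Finset.sum_sub_distrib, sum_range_char_eq_zero hχ, sub_zero]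
    rfl
  rw [this]
  refine norm_sum_char_mul_le χ _ fun r hr => ?_
  have h1 := norm_ofReal_mul_le (ρ := (r / q : ℝ)) (by positivity)
    (div_le_one_of_mem_range hr) (η := η)
  have h2 := Complex.norm_exp_sub_one_le (x := -(((r / q : ℝ) : ℂ) * η))
    (by rw [norm_neg]; linarith)
  rw [norm_neg] at h2
  linarith

lemma norm_charBlock_sub_le (s : ℂ) {m : ℕ} (hm : 1 ≤ m) (hs : 2 * ‖s‖ ≤ m) :
    ‖charBlock χ s m - (q : ℂ) ^ (-s) * ((m : ℂ) ^ (-s) * charExpSum χ (s / m))‖ ≤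
      ‖(q : ℂ) ^ (-s)‖ * (‖(m : ℂ) ^ (-s)‖ * (q * (6 * ‖s‖ / m ^ 2))) := by
  have hq : (0 : ℝ) < q := by exact_mod_cast NeZero.pos q
  have key : charBlock χ s m - (q : ℂ) ^ (-s) * ((m : ℂ) ^ (-s) * charExpSum χ (s / m)) =
      (q : ℂ) ^ (-s) * ∑ r ∈ Finset.range q, χ ((r : ℕ) : ZMod q) *
        ((((m : ℝ) + r / q : ℝ) : ℂ) ^ (-s) -
          ((m : ℝ) : ℂ) ^ (-s) * Complex.exp (-(((r / q : ℝ) : ℂ) * (s / (m : ℝ))))) := by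
    unfold charBlock charExpSum
    rw [Finset.mul_sum, Finset.mul_sum, Finset.mul_sum, ← Finset.sum_sub_distrib]
    refine Finset.sum_congr rfl fun r _ => ?_
    have : ((q * m + r : ℕ) : ℂ) = ((q : ℝ) : ℂ) * (((m : ℝ) + r / q : ℝ) : ℂ) := by
      rw [← Complex.ofReal_mul, mul_add, mul_div_cancel₀ _ hq.ne']; push_cast; ring
    rw [this, Complex.mul_cpow_ofReal_nonneg hq.le (by positivity)]
    simp only [Complex.ofReal_natCast]
    ring
  rw [key, norm_mul]
  refine mul_le_mul_of_nonneg_left ?_ (norm_nonneg _)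
  rw [mul_left_comm]
  refine norm_sum_char_mul_le χ _ fun r hr => ?_
  have := norm_add_cpow_neg_sub_le (x := m) (ρ := (r / q : ℝ)) (by exact_mod_cast hm)
    (by positivity) (div_le_one_of_mem_range hr) hs
  simpa using this

lemma norm_natCast_cpow_neg_le_one (s : ℂ) (hs : 0 ≤ s.re) {m : ℕ} (hm : 1 ≤ m) :
    ‖(m : ℂ) ^ (-s)‖ ≤ 1 := by
  rw [Complex.norm_natCast_cpow_of_pos hm, Complex.neg_re]
  exact Real.rpow_le_one_of_one_le_of_nonpos (by exact_mod_cast hm) (by linarith)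

/-- Cancellation over one period gains a factor `|s|/m`. The factor `|s|` is too costly for the
final truncation error, but the bound suffices for convergence. -/
lemma norm_charBlock_le (hχ : χ ≠ 1) (s : ℂ) (hre : 1 / 4 ≤ s.re) {m : ℕ} (hm : 1 ≤ m)
    (hs : 2 * ‖s‖ ≤ m) :
    ‖charBlock χ s m‖ ≤ 8 * q * ‖s‖ * (m : ℝ) ^ (-(5 / 4) : ℝ) := by
  have hm1 : (1 : ℝ) ≤ m := by exact_mod_cast hm
  have hη : ‖s / m‖ = ‖s‖ / m := by simp
  have h1 := norm_charBlock_sub_le (χ := χ) s hm hs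
  have h2 := norm_charExpSum_le hχ (η := s / m)
    (by rw [hη, div_le_iff₀ (by linarith)]; linarith)
  rw [hη] at h2
  have h3 : ‖(m : ℂ) ^ (-s)‖ ≤ (m : ℝ) ^ (-(1 / 4) : ℝ) := by
    rw [Complex.norm_natCast_cpow_of_pos hm, Complex.neg_re]
    exact Real.rpow_le_rpow_of_exponent_le hm1 (by linarith)
  have h4 := norm_natCast_cpow_neg_le_one s (by linarith) (NeZero.one_le (n := q))
  have h5 : (m : ℝ) ^ (-(5 / 4) : ℝ) = (m : ℝ) ^ (-(1 / 4) : ℝ) * (m : ℝ)⁻¹ := by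
    rw [← Real.rpow_neg_one, ← Real.rpow_add (by linarith)]; norm_num
  have h6 : ‖s‖ / (m : ℝ) ^ 2 ≤ ‖s‖ / m :=
    div_le_div_of_nonneg_left (norm_nonneg _) (by linarith) (by nlinarith)
  have h7 : 0 ≤ (m : ℝ) ^ (-(1 / 4) : ℝ) := by positivity
  have h8 : ‖charBlock χ s m‖ ≤ ‖(q : ℂ) ^ (-s)‖ * (‖(m : ℂ) ^ (-s)‖ *
      (q * (6 * ‖s‖ / m ^ 2) + q * (2 * (‖s‖ / m)))) := by
    calc _ ≤ _ := norm_le_norm_sub_add _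
              ((q : ℂ) ^ (-s) * ((m : ℂ) ^ (-s) * charExpSum χ (s / m)))
      _ ≤ _ := by
        rw [norm_mul, norm_mul, mul_add, mul_add]
        gcongr
  refine h8.trans ?_
  calc _ ≤ 1 * ((m : ℝ) ^ (-(1 / 4) : ℝ) * (q * (6 * (‖s‖ / m)) + q * (2 * (‖s‖ / m)))) := by
        rw [mul_div_assoc]
        gcongr
    _ = _ := by rw [h5]; ring

/-- Grouped in periods, the series converges uniformly on bounded parts of the half-plane, so its
sum is analytic there. It agrees with `L` for real part above 1, hence everywhere by the identity
theorem. -/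
lemma tendsto_sum_charBlock (hχ : χ ≠ 1) {s : ℂ} (hs : 1 / 4 < s.re) :
    Filter.Tendsto (fun M : ℕ => ∑ m ∈ Finset.range M, charBlock χ s m) Filter.atTop
      (nhds (DirichletCharacter.LFunction χ s)) := by
  -- The ball has to contain both `s` and the point 2, where the comparison with the absolutely
  -- convergent series starts.
  set R : ℝ := ‖s‖ + 3
  set U : Set ℂ := {z | 1 / 4 < z.re} ∩ Metric.ball 0 R
  have hUo : IsOpen U := (isOpen_lt continuous_const Complex.continuous_re).inter Metric.isOpen_ball
  have hUc : IsPreconnected U :=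
    ((convex_halfSpace_re_gt _).inter (convex_ball _ _)).isPreconnected
  obtain ⟨M₀, hM₀⟩ := exists_nat_ge (2 * R + 1)
  have hRpos : 0 ≤ R := by positivity
  have hbound : ∀ (m : ℕ), ∀ z ∈ U, ‖charBlock χ z (m + M₀)‖ ≤
      8 * q * R * ((m + M₀ : ℕ) : ℝ) ^ (-(5 / 4) : ℝ) := by
    intro m z hz
    have hzR : ‖z‖ ≤ R := by simpa using (mem_ball_zero_iff.1 hz.2).le
    have h1 : (2 * R + 1) ≤ ((m + M₀ : ℕ) : ℝ) := by push_cast; linarith [m.cast_nonneg (α := ℝ)]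
    refine (norm_charBlock_le hχ z hz.1.le ?_ (by linarith)).trans (by gcongr)
    have : (1 : ℝ) ≤ ((m + M₀ : ℕ) : ℝ) := by linarith
    exact_mod_cast this
  have hsum : Summable fun m : ℕ => 8 * q * R * ((m + M₀ : ℕ) : ℝ) ^ (-(5 / 4) : ℝ) := by
    refine Summable.mul_left _ ?_
    rw [summable_nat_add_iff (f := fun m : ℕ => (m : ℝ) ^ (-(5 / 4) : ℝ))]
    exact Real.summable_nat_rpow.2 (by norm_num)
  have hdb : ∀ m, M₀ ≤ m → DifferentiableOn ℂ (fun z => charBlock χ z m) U := by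
    intro m hm
    have : (1 : ℝ) ≤ m := by
      have : (M₀ : ℝ) ≤ m := by exact_mod_cast hm
      linarith
    have hm1 : 1 ≤ m := by exact_mod_cast this
    unfold charBlock
    refine DifferentiableOn.fun_sum fun r _ => ?_
    refine DifferentiableOn.const_mul ?_ _
    refine DifferentiableOn.const_cpow (differentiableOn_neg _) (Or.inl ?_)
    have := Nat.mul_pos (NeZero.pos q) hm1
    exact_mod_cast (by omega : q * m + r ≠ 0)
  have hdt : DifferentiableOn ℂ (fun z => ∑' m : ℕ, charBlock χ z (m + M₀)) U :=
    Complex.differentiableOn_tsum_of_summable_norm hsum (fun m => hdb _ (by omega)) hUo hbound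
  have hd0 : DifferentiableOn ℂ (fun z => ∑ m ∈ Finset.range M₀, charBlock χ z m) U := by
    unfold charBlock
    refine DifferentiableOn.fun_sum fun m _ => DifferentiableOn.fun_sum fun r _ => ?_
    refine DifferentiableOn.const_mul ?_ _
    refine DifferentiableOn.const_cpow (differentiableOn_neg _) (Or.inr fun z hz => ?_)
    intro h
    have := hz.1
    rw [neg_eq_zero.1 h] at this
    norm_num at this
  have hG : ∀ z ∈ U, Filter.Tendsto (fun M : ℕ => ∑ m ∈ Finset.range M, charBlock χ z m)
      Filter.atTop (nhds (∑ m ∈ Finset.range M₀, charBlock χ z m +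
        ∑' m : ℕ, charBlock χ z (m + M₀))) := by
    intro z hz
    have hsz : Summable fun m : ℕ => charBlock χ z (m + M₀) :=
      Summable.of_norm_bounded hsum fun m => hbound m z hz
    have := (summable_nat_add_iff M₀).1 hsz
    rw [this.sum_add_tsum_nat_add]
    exact this.hasSum.tendsto_sum_nat
  have hLS : ∀ z : ℂ, 1 < z.re →
      Filter.Tendsto (fun M : ℕ => ∑ m ∈ Finset.range M, charBlock χ z m) Filter.atTop
        (nhds (DirichletCharacter.LFunction χ z)) := by
    intro z hz
    rw [DirichletCharacter.LFunction_eq_LSeries χ hz]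
    have h1 := (DirichletCharacter.LSeriesSummable_of_one_lt_re χ hz).hasSum.tendsto_sum_nat
    have h2 := h1.comp (Filter.tendsto_id.const_mul_atTop' (NeZero.pos q))
    refine h2.congr fun M => ?_
    rw [sum_range_charBlock]
    refine Finset.sum_congr rfl fun n _ => ?_
    rcases eq_or_ne n 0 with rfl | hn
    · have : z ≠ 0 := by rintro rfl; norm_num at hz
      simp [this]
    · rw [LSeries.term_of_ne_zero hn, Complex.cpow_neg, div_eq_mul_inv]
  have heq : Set.EqOn (fun z => ∑ m ∈ Finset.range M₀, charBlock χ z m +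
      ∑' m : ℕ, charBlock χ z (m + M₀)) (DirichletCharacter.LFunction χ) U := by
    have h2U : (2 : ℂ) ∈ U := by
      refine ⟨by norm_num, ?_⟩
      simp only [Metric.mem_ball, dist_zero_right, Complex.norm_ofNat, R]
      linarith [norm_nonneg s]
    refine AnalyticOnNhd.eqOn_of_preconnected_of_eventuallyEq
      ((hd0.add hdt).analyticOnNhd hUo)
      ((DirichletCharacter.differentiable_LFunction hχ).differentiableOn.analyticOnNhd hUo)
      hUc h2U ?_
    filter_upwards [hUo.mem_nhds h2U, (isOpen_lt continuous_const Complex.continuous_re).mem_nhds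
      (show (1 : ℝ) < (2 : ℂ).re by norm_num)] with z hz hz1
    exact tendsto_nhds_unique (hG z hz) (hLS z hz1)
  have hsU : s ∈ U := ⟨hs, by simp [R]⟩
  rw [← heq hsU]
  exact hG s hsU

/-- Truncation of the Dirichlet series on the critical line. -/
lemma exists_norm_LFunction_sub_sum_le : ∃ A : ℝ, 0 < A ∧
    ∀ (q : ℕ) [NeZero q] (χ : DirichletCharacter ℂ q), χ ≠ 1 → ∀ s : ℂ, s.re = 1 / 2 →
      ∀ M : ℕ, 1 ≤ M → 2 * ‖s‖ ≤ M →
        ‖DirichletCharacter.LFunction χ s -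
          ∑ n ∈ Finset.range (q * M), χ (n : ZMod q) * (n : ℂ) ^ (-s)‖ ≤ A * √(q / M) := by
  obtain ⟨L, hL0, hL⟩ := exists_lipschitz_expRatio
  refine ⟨L + 38, by positivity, fun q _ χ hχ s hs M hM hsM => ?_⟩
  have hq0 : (0 : ℝ) < q := by exact_mod_cast NeZero.pos q
  have hM0 : (1 : ℝ) ≤ M := by exact_mod_cast hM
  -- Since `m^{-s}(e^{-s/m} - 1)` is nearly `(m+1)^{-s} - m^{-s}`, block `m` is nearly
  -- `q^{-s}(g(m+1) - g(m))`.
  set g : ℕ → ℂ := fun m => (m : ℂ) ^ (-s) * charExpQuot χ (s / m) with hg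
  have hnorm : ∀ m : ℕ, 1 ≤ m → ‖(m : ℂ) ^ (-s)‖ = (m : ℝ) ^ (-(1 / 2) : ℝ) := fun m hm => by
    rw [Complex.norm_natCast_cpow_of_pos hm, Complex.neg_re, hs]
  have hanti : ∀ m n : ℕ, 1 ≤ m → m ≤ n → ‖(n : ℂ) ^ (-s)‖ ≤ ‖(m : ℂ) ^ (-s)‖ := by
    intro m n hm hmn
    rw [hnorm m hm, hnorm n (hm.trans hmn)]
    exact Real.rpow_le_rpow_of_nonpos (by exact_mod_cast hm) (by exact_mod_cast hmn) (by norm_num)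
  have hη : ∀ m : ℕ, M ≤ m → ‖s / m‖ ≤ 1 / 2 := fun m hm => by
    have : (M : ℝ) ≤ m := by exact_mod_cast hm
    rw [norm_div, Complex.norm_natCast, div_le_iff₀ (by linarith)]; linarith
  have hQ : ∀ m : ℕ, M ≤ m → ‖charExpQuot χ (s / m)‖ ≤ q * 4 := fun m hm =>
    norm_sum_char_mul_le χ _ fun r hr =>
      norm_expRatio_le (by positivity) (div_le_one_of_mem_range hr) (hη m hm)
  have hgM : ∀ m : ℕ, M ≤ m → ‖g m‖ ≤ ‖(M : ℂ) ^ (-s)‖ * (q * 4) := fun m hm => by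
    rw [hg, norm_mul]
    exact mul_le_mul (hanti M m hM hm) (hQ m hm) (norm_nonneg _) (norm_nonneg _)
  -- The constant is `L + 30 = 6 + L + 6·4`: the block approximation, the variation of
  -- `charExpQuot`, and the approximation of `(m+1)^{-s}` times the bound `4q`.
  have hstep : ∀ m : ℕ, M ≤ m → ‖charBlock χ s m - (q : ℂ) ^ (-s) * (g (m + 1) - g m)‖ ≤
      ‖(q : ℂ) ^ (-s)‖ * (‖(M : ℂ) ^ (-s)‖ * (q * ((L + 30) * ‖s‖))) * ((m : ℝ) ^ 2)⁻¹ := by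
    intro m hm
    have hm1 : 1 ≤ m := hM.trans hm
    have hmr : (1 : ℝ) ≤ m := by exact_mod_cast hm1
    have hsm : 2 * ‖s‖ ≤ m := hsM.trans (by exact_mod_cast hm)
    have h1 := norm_charBlock_sub_le (χ := χ) s hm1 hsm
    have h2 := charExpQuot_mul hχ (hη m hm)
    have h3 := norm_add_cpow_neg_sub_le (x := m) (ρ := 1) hmr (by norm_num) le_rfl hsm
    have h4 : ‖charExpQuot χ (s / (m + 1 : ℕ)) - charExpQuot χ (s / m)‖ ≤
        q * (L * (‖s‖ / m ^ 2)) := by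
      unfold charExpQuot
      rw [← Finset.sum_sub_distrib]
      simp only [← mul_sub]
      refine norm_sum_char_mul_le χ _ fun r hr => ?_
      refine (hL _ (by positivity) (div_le_one_of_mem_range hr) _ _ (hη _ (by omega))
        (hη m hm)).trans ?_
      refine mul_le_mul_of_nonneg_left ?_ hL0
      have hmc : (m : ℂ) ≠ 0 := by exact_mod_cast (by omega : m ≠ 0)
      have hmc1 : (m : ℂ) + 1 ≠ 0 := by exact_mod_cast (by omega : m + 1 ≠ 0)
      have : s / ((m + 1 : ℕ) : ℂ) - s / m = -(s / (((m + 1) * m : ℕ) : ℂ)) := by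
        push_cast; field_simp; ring
      rw [this, norm_neg, norm_div, Complex.norm_natCast]
      refine div_le_div_of_nonneg_left (norm_nonneg _) (by positivity) ?_
      push_cast; nlinarith
    have h5 : g (m + 1) - g m - (m : ℂ) ^ (-s) * charExpSum χ (s / m) =
        ((m + 1 : ℕ) : ℂ) ^ (-s) *
          (charExpQuot χ (s / (m + 1 : ℕ)) - charExpQuot χ (s / m)) +
        (((m + 1 : ℕ) : ℂ) ^ (-s) - (m : ℂ) ^ (-s) * Complex.exp (-(s / m))) *
          charExpQuot χ (s / m) := by
      rw [hg, ← h2]; ring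
    have h3' : ‖((m + 1 : ℕ) : ℂ) ^ (-s) - (m : ℂ) ^ (-s) * Complex.exp (-(s / m))‖ ≤
        ‖(m : ℂ) ^ (-s)‖ * (6 * ‖s‖ / m ^ 2) := by simpa using h3
    have h6 : ‖g (m + 1) - g m - (m : ℂ) ^ (-s) * charExpSum χ (s / m)‖ ≤
        ‖(m : ℂ) ^ (-s)‖ * (q * (L * (‖s‖ / m ^ 2))) +
          ‖(m : ℂ) ^ (-s)‖ * (6 * ‖s‖ / m ^ 2) * (q * 4) := by
      rw [h5]
      refine (norm_add_le _ _).trans (add_le_add ?_ ?_)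
      · rw [norm_mul]
        exact mul_le_mul (hanti m (m + 1) hm1 (by omega)) h4 (norm_nonneg _) (norm_nonneg _)
      · rw [norm_mul]
        exact mul_le_mul h3' (hQ m hm) (norm_nonneg _) (by positivity)
    calc _ = ‖(charBlock χ s m - (q : ℂ) ^ (-s) * ((m : ℂ) ^ (-s) * charExpSum χ (s / m))) -
          (q : ℂ) ^ (-s) * (g (m + 1) - g m - (m : ℂ) ^ (-s) * charExpSum χ (s / m))‖ := by
          congr 1; ring
      _ ≤ ‖(q : ℂ) ^ (-s)‖ * (‖(m : ℂ) ^ (-s)‖ * (q * (6 * ‖s‖ / m ^ 2))) +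
          ‖(q : ℂ) ^ (-s)‖ * (‖(m : ℂ) ^ (-s)‖ * (q * (L * (‖s‖ / m ^ 2))) +
          ‖(m : ℂ) ^ (-s)‖ * (6 * ‖s‖ / m ^ 2) * (q * 4)) := by
          refine (norm_sub_le _ _).trans (add_le_add h1 ?_)
          rw [norm_mul]
          exact mul_le_mul_of_nonneg_left h6 (norm_nonneg _)
      _ = ‖(q : ℂ) ^ (-s)‖ * (‖(m : ℂ) ^ (-s)‖ * (q * ((L + 30) * ‖s‖))) * ((m : ℝ) ^ 2)⁻¹ := by
          rw [div_eq_mul_inv, div_eq_mul_inv]; ring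
      _ ≤ _ := by
          have := hanti M m hM hm
          gcongr
  have hfin : ∀ M' : ℕ, M ≤ M' → ‖∑ m ∈ Finset.range M', charBlock χ s m -
      ∑ m ∈ Finset.range M, charBlock χ s m‖ ≤ (L + 38) * √(q / M) := by
    intro M' hM'
    rw [← Finset.sum_Ico_eq_sub _ hM']
    have htel : ∑ m ∈ Finset.Ico M M', (g (m + 1) - g m) = g M' - g M :=
      Finset.sum_Ico_sub g hM'
    have hd : ∑ m ∈ Finset.Ico M M', charBlock χ s m =
        ∑ m ∈ Finset.Ico M M', (charBlock χ s m - (q : ℂ) ^ (-s) * (g (m + 1) - g m)) +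
        (q : ℂ) ^ (-s) * (g M' - g M) := by
      rw [Finset.sum_sub_distrib, ← Finset.mul_sum, htel]; ring
    have hsq : ∑ m ∈ Finset.Ico M M', ((m : ℝ) ^ 2)⁻¹ ≤ 2 / M := by
      have := sum_Ioo_inv_sq_le (α := ℝ) (M - 1) M'
      have e : Finset.Ioo (M - 1) M' = Finset.Ico M M' := by
        ext x; simp only [Finset.mem_Ioo, Finset.mem_Ico]; omega
      rw [e, Nat.cast_sub hM] at this
      simpa using this
    have hE : ‖∑ m ∈ Finset.Ico M M', (charBlock χ s m - (q : ℂ) ^ (-s) * (g (m + 1) - g m))‖ ≤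
        ‖(q : ℂ) ^ (-s)‖ * (‖(M : ℂ) ^ (-s)‖ * (q * (L + 30))) := by
      refine (norm_sum_le_of_le _ fun m hm => hstep m (Finset.mem_Ico.1 hm).1).trans ?_
      rw [← Finset.mul_sum]
      calc _ ≤ ‖(q : ℂ) ^ (-s)‖ * (‖(M : ℂ) ^ (-s)‖ * (q * ((L + 30) * ‖s‖))) * (2 / M) := by
            gcongr
        _ = ‖(q : ℂ) ^ (-s)‖ * (‖(M : ℂ) ^ (-s)‖ * (q * (L + 30))) * (2 * ‖s‖ / M) := by ring
        -- The factor `|s|` from the second-order errors is absorbed by the tail of `∑ 1/m²`,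
        -- because `2|s| ≤ M`.
        _ ≤ _ := by
            refine mul_le_of_le_one_right (by positivity) ?_
            rw [div_le_one (by linarith)]; exact hsM
    have hB : ‖(q : ℂ) ^ (-s) * (g M' - g M)‖ ≤
        ‖(q : ℂ) ^ (-s)‖ * (‖(M : ℂ) ^ (-s)‖ * (q * 8)) := by
      rw [norm_mul]
      refine mul_le_mul_of_nonneg_left ?_ (norm_nonneg _)
      refine (norm_sub_le _ _).trans ((add_le_add (hgM M' hM') (hgM M le_rfl)).trans_eq (by ring))
    rw [hd]
    refine (norm_add_le _ _).trans ((add_le_add hE hB).trans_eq ?_)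
    rw [hnorm q NeZero.one_le, hnorm M hM, Real.rpow_neg hq0.le, Real.rpow_neg (by linarith),
      ← Real.sqrt_eq_rpow, ← Real.sqrt_eq_rpow, Real.sqrt_div hq0.le]
    have := Real.mul_self_sqrt hq0.le
    have h1 : √(q : ℝ) ≠ 0 := (Real.sqrt_pos.2 hq0).ne'
    have h2 : √(M : ℝ) ≠ 0 := (Real.sqrt_pos.2 (by linarith)).ne'
    field_simp
    rw [sq, this]; ring
  have hlim := ((tendsto_sum_charBlock hχ (s := s) (by rw [hs]; norm_num)).sub_const
    (∑ m ∈ Finset.range M, charBlock χ s m)).norm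
  rw [← sum_range_charBlock]
  exact le_of_tendsto hlim (Filter.eventually_atTop.2 ⟨M, hfin⟩)

end

/-! ### A divisor bound -/

section
open Finset

/-- Primes below `z` are few, and each contributes at most a logarithm. For the others `v + 1 ≤
2^v`, and their exponents add up to at most `log N / log z`. -/
lemma card_divisors_le_rpow {z : ℝ} (hz : 1 < z) {n N : ℕ} (hn : n ≠ 0) (hnN : n ≤ N) :
    (n.divisors.card : ℝ) ≤
      (1 + 2 * Real.log N) ^ z * (2 : ℝ) ^ (Real.log N / Real.log z) := by
  have hn1 : (1 : ℝ) ≤ n := by exact_mod_cast Nat.one_le_iff_ne_zero.2 hn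
  have hN1 : (n : ℝ) ≤ N := by exact_mod_cast hnN
  have hlogn : Real.log n ≤ Real.log N := Real.log_le_log (by linarith) hN1
  have hlogN : 0 ≤ Real.log N := Real.log_nonneg (by linarith)
  have hlogz : 0 < Real.log z := Real.log_pos hz
  rw [Nat.card_divisors hn]
  push_cast
  rw [← prod_filter_mul_prod_filter_not n.primeFactors (fun p : ℕ => (p : ℝ) < z)]
  refine mul_le_mul ?_ ?_ (by positivity) (by positivity)
  · have h1 : ∀ p ∈ n.primeFactors.filter (fun p : ℕ => (p : ℝ) < z),
        ((n.factorization p : ℝ) + 1) ≤ 1 + 2 * Real.log N := by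
      intro p hp
      have hpp : p.Prime := Nat.prime_of_mem_primeFactors (mem_filter.1 hp).1
      have h2 : 2 ^ n.factorization p ≤ n :=
        (Nat.pow_le_pow_left hpp.two_le _).trans (Nat.ordProj_le p hn)
      have h3 : (2 : ℝ) ^ n.factorization p ≤ n := by exact_mod_cast h2
      have h4 := Real.log_le_log (by positivity) h3
      rw [Real.log_pow] at h4
      have h5 := Real.log_two_gt_d9
      have h6 : (0 : ℝ) ≤ n.factorization p := by positivity
      nlinarith
    refine (prod_le_prod (fun p _ => by positivity) h1).trans ?_
    rw [prod_const, ← Real.rpow_natCast]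
    refine Real.rpow_le_rpow_of_exponent_le (by linarith) ?_
    have hsub : n.primeFactors.filter (fun p : ℕ => (p : ℝ) < z) ⊆ Ico 1 ⌈z⌉₊ := by
      intro p hp
      rw [mem_filter] at hp
      exact mem_Ico.2 ⟨(Nat.prime_of_mem_primeFactors hp.1).one_lt.le, Nat.lt_ceil.2 hp.2⟩
    have h7 := card_le_card hsub
    rw [Nat.card_Ico] at h7
    have h8 := Nat.ceil_lt_add_one (show (0 : ℝ) ≤ z by linarith)
    have h9 : 1 ≤ ⌈z⌉₊ := Nat.one_le_ceil_iff.2 (by linarith)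
    have h10 : ((n.primeFactors.filter (fun p : ℕ => (p : ℝ) < z)).card : ℝ) ≤ (⌈z⌉₊ : ℝ) - 1 := by
      have : ((n.primeFactors.filter (fun p : ℕ => (p : ℝ) < z)).card : ℝ) ≤ ((⌈z⌉₊ - 1 : ℕ) : ℝ) := by
        exact_mod_cast h7
      rwa [Nat.cast_sub h9, Nat.cast_one] at this
    linarith
  · set S := n.primeFactors.filter (fun p : ℕ => ¬ (p : ℝ) < z) with hS
    have h1 : ∏ p ∈ S, ((n.factorization p : ℝ) + 1) ≤ 2 ^ (∑ p ∈ S, n.factorization p) := by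
      rw [← prod_pow_eq_pow_sum]
      refine prod_le_prod (fun p _ => by positivity) fun p _ => ?_
      exact_mod_cast Nat.lt_two_pow_self (n := n.factorization p)
    have h2 : z ^ (∑ p ∈ S, n.factorization p) ≤ n := by
      rw [← prod_pow_eq_pow_sum]
      calc ∏ p ∈ S, z ^ n.factorization p ≤ ∏ p ∈ S, (p : ℝ) ^ n.factorization p := by
            refine prod_le_prod (fun p _ => by positivity) fun p hp => ?_
            exact pow_le_pow_left₀ (by linarith) (not_lt.1 (mem_filter.1 hp).2) _
        _ ≤ n := by
            have h3 : ∏ p ∈ S, p ^ n.factorization p ≤ ∏ p ∈ n.primeFactors,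
                p ^ n.factorization p :=
              prod_le_prod_of_subset_of_one_le' (filter_subset _ _) fun p hp _ =>
                Nat.one_le_pow _ _ (Nat.prime_of_mem_primeFactors hp).pos
            have h4 : ∏ p ∈ n.primeFactors, p ^ n.factorization p = n :=
              Nat.prod_factorization_pow_eq_self hn
            rw [h4] at h3
            exact_mod_cast h3
    have h3 := Real.log_le_log (by positivity) h2
    rw [Real.log_pow] at h3
    refine h1.trans ?_
    rw [← Real.rpow_natCast]
    refine Real.rpow_le_rpow_of_exponent_le (by norm_num) ?_
    rw [le_div_iff₀ hlogz]
    linarith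

/-! ### Averages over an arithmetic progression -/

/-- A majorant of `‖∑ k ∈ Icc 1 K, z ^ k‖ / K` when the argument of `z` lies in the `i`-th of `K`
equal arcs. -/
noncomputable def arcWeight (K i : ℕ) : ℝ := 1 / ((i : ℝ) + 1) + 1 / ((K : ℝ) - i)

lemma sum_arcWeight_le (K : ℕ) : ∑ i ∈ range K, arcWeight K i ≤ 2 * (1 + Real.log K) := by
  have h1 : ∑ i ∈ range K, 1 / ((i : ℝ) + 1) ≤ 1 + Real.log K := by
    have := harmonic_le_one_add_log K
    unfold harmonic at this
    push_cast at this
    simpa using this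
  have h2 : ∑ i ∈ range K, 1 / ((K : ℝ) - i) = ∑ i ∈ range K, 1 / ((i : ℝ) + 1) := by
    rw [← sum_range_reflect]
    refine sum_congr rfl fun i hi => ?_
    have : i + 1 ≤ K := by simpa using hi
    rw [Nat.sub_sub, Nat.cast_sub (by omega)]
    push_cast
    congr 1; ring
  unfold arcWeight
  rw [sum_add_distrib, h2]
  linarith

lemma arcWeight_nonneg {K i : ℕ} (hi : i < K) : 0 ≤ arcWeight K i := by
  have : (i : ℝ) < K := by exact_mod_cast hi
  have : 0 < (K : ℝ) - i := by linarith
  unfold arcWeight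
  positivity

/-- The geometric sum is at most `2/|z - 1|`, and `|z - 1| = 2 sin(πφ)` is bounded below by Jordan's
inequality from the nearer end of the circle. In the two arcs touching 1 the trivial bound `K` is
used. -/
lemma norm_sum_pow_le_arcWeight {K : ℕ} (hK : 0 < K) (v : ℕ) {x : ℝ} (h0 : (v : ℝ) ≤ K * x)
    (h1 : K * x < v + 1) :
    ‖∑ k ∈ Icc 1 K, Complex.exp (Complex.I * ((2 * Real.pi * x : ℝ) : ℂ)) ^ k‖ ≤
      K * arcWeight K (v % K) := by
  set i := v % K with hi
  have hiK : i < K := Nat.mod_lt _ hK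
  have hKr : (0 : ℝ) < K := by exact_mod_cast hK
  have hir : (i : ℝ) + 1 ≤ K := by exact_mod_cast hiK
  -- The division is of natural numbers: it counts the whole turns, leaving the fractional phase
  -- `φ`.
  set φ : ℝ := x - (v / K : ℕ) with hφ
  have hv : (v : ℝ) = K * (v / K : ℕ) + i := by exact_mod_cast (Nat.div_add_mod v K).symm
  have hφ0 : (i : ℝ) ≤ K * φ := by rw [hφ]; nlinarith
  have hφ1 : K * φ < i + 1 := by rw [hφ]; nlinarith
  set z := Complex.exp (Complex.I * ((2 * Real.pi * φ : ℝ) : ℂ)) with hz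
  have hzx : Complex.exp (Complex.I * ((2 * Real.pi * x : ℝ) : ℂ)) = z := by
    rw [hz, Complex.exp_eq_exp_iff_exists_int]
    refine ⟨((v / K : ℕ) : ℤ), ?_⟩
    rw [hφ, Int.cast_natCast]; push_cast; ring
  rw [hzx]
  have hzn : ‖z‖ = 1 := Complex.norm_exp_I_mul_ofReal _
  have htriv : ‖∑ k ∈ Icc 1 K, z ^ k‖ ≤ K := by
    refine (norm_sum_le_of_le (n := fun _ => (1 : ℝ)) _ fun k _ => by simp [hzn]).trans ?_
    simp
  have hφpos : 0 ≤ φ := by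
    by_contra h
    have : (0 : ℝ) ≤ i := by positivity
    nlinarith
  have hφlt : φ ≤ 1 := by
    by_contra h
    nlinarith
  have hsin : ‖z - 1‖ = 2 * Real.sin (Real.pi * φ) := by
    rw [hz, Complex.norm_exp_I_mul_ofReal_sub_one, show 2 * Real.pi * φ / 2 = Real.pi * φ by ring,
      Real.norm_of_nonneg]
    refine mul_nonneg (by norm_num) (Real.sin_nonneg_of_nonneg_of_le_pi (by positivity) ?_)
    nlinarith [Real.pi_pos]
  have hgeom : ∀ c : ℝ, 0 < c → c ≤ ‖z - 1‖ → ‖∑ k ∈ Icc 1 K, z ^ k‖ ≤ 2 / c := by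
    intro c hc hcz
    have hz1 : z ≠ 1 := by
      rintro h; rw [h, sub_self, norm_zero] at hcz; linarith
    have hshift : ∑ k ∈ Icc 1 K, z ^ k = z * ∑ k ∈ range K, z ^ k := by
      have : Icc 1 K = Ico 1 (K + 1) := by ext; simp
      rw [this, sum_Ico_eq_sum_range, mul_sum]
      exact sum_congr rfl fun k _ => by rw [pow_add, pow_one]
    rw [hshift, geom_sum_eq hz1, norm_mul, hzn, one_mul, norm_div]
    have : ‖z ^ K - 1‖ ≤ 2 := by
      refine (norm_sub_le _ _).trans ?_
      simp [hzn]; norm_num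
    exact div_le_div₀ (by norm_num) this hc hcz
  have hw1 : (1 : ℝ) / (i + 1) ≤ arcWeight K i := by
    unfold arcWeight
    have : 0 < (K : ℝ) - i := by linarith
    have : 0 ≤ 1 / ((K : ℝ) - i) := by positivity
    linarith
  have hw2 : (1 : ℝ) / (K - i) ≤ arcWeight K i := by
    unfold arcWeight
    have : 0 ≤ 1 / ((i : ℝ) + 1) := by positivity
    linarith
  have hpi := Real.pi_pos
  rcases le_total φ (1 / 2) with h | h
  · refine le_trans ?_ (mul_le_mul_of_nonneg_left hw1 hKr.le)
    rcases Nat.eq_zero_or_pos i with h0 | h0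
    · rw [h0]; simpa using htriv
    · have hi1 : (1 : ℝ) ≤ i := by exact_mod_cast h0
      have hs := Real.mul_le_sin (x := Real.pi * φ) (by positivity) (by nlinarith)
      have e : 2 / Real.pi * (Real.pi * φ) = 2 * φ := by field_simp
      rw [e] at hs
      have hc : 4 * (i / K : ℝ) ≤ ‖z - 1‖ := by
        rw [hsin]
        have : (i / K : ℝ) ≤ φ := by rw [div_le_iff₀ hKr]; linarith
        linarith
      refine (hgeom _ (by positivity) hc).trans ?_
      rw [div_le_iff₀ (by positivity)]
      have : K * (1 / ((i : ℝ) + 1)) * (4 * (i / K)) = 4 * i / (i + 1) := by field_simp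
      rw [this, le_div_iff₀ (by linarith)]
      linarith
  · refine le_trans ?_ (mul_le_mul_of_nonneg_left hw2 hKr.le)
    rcases eq_or_lt_of_le hir with h0 | h0
    · have : (K : ℝ) - i = 1 := by linarith
      rw [this]; simpa using htriv
    · have hi2 : (i : ℝ) + 2 ≤ K := by
        have : i + 1 < K := by exact_mod_cast h0
        exact_mod_cast this
      have hs := Real.mul_le_sin (x := Real.pi - Real.pi * φ) (by nlinarith) (by nlinarith)
      rw [Real.sin_pi_sub] at hs
      have e : 2 / Real.pi * (Real.pi - Real.pi * φ) = 2 * (1 - φ) := by field_simp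
      rw [e] at hs
      have hc : 4 * ((K - i - 1) / K : ℝ) ≤ ‖z - 1‖ := by
        rw [hsin]
        have : ((K - i - 1) / K : ℝ) ≤ 1 - φ := by rw [div_le_iff₀ hKr]; nlinarith
        linarith
      have hp : 0 < (K : ℝ) - i - 1 := by linarith
      have hp' : 0 < (K : ℝ) - i := by linarith
      refine (hgeom _ (by positivity) hc).trans ?_
      rw [div_le_iff₀ (by positivity)]
      have : K * (1 / ((K : ℝ) - i)) * (4 * ((K - i - 1) / K)) = 4 * (K - i - 1) / (K - i) := by
        field_simp
      rw [this, le_div_iff₀ (by linarith)]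
      linarith

lemma norm_sum_cpow_progression_le {K : ℕ} (hK : 0 < K) (a : ℝ) {b : ℝ} (hb : 0 < b) {n : ℕ}
    (hn : 1 ≤ n) :
    ‖∑ k ∈ Icc 1 K, (n : ℂ) ^ (-(1 / 2 + Complex.I * ((a + (k : ℝ) * b : ℝ) : ℂ)))‖ ≤
      K * arcWeight K (⌊K * (b * Real.log n / (2 * Real.pi))⌋₊ % K) * (√n)⁻¹ := by
  have hn0 : (n : ℂ) ≠ 0 := by exact_mod_cast (by omega : n ≠ 0)
  set x := b * Real.log n / (2 * Real.pi) with hx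
  have hlog : 0 ≤ Real.log n := Real.log_natCast_nonneg n
  have hpi := Real.pi_pos
  have hx0 : 0 ≤ K * x := by positivity
  have h1 := norm_sum_pow_le_arcWeight hK _ (Nat.floor_le hx0) (Nat.lt_floor_add_one _)
  have e2 : 2 * Real.pi * x = b * Real.log n := by rw [hx]; field_simp
  rw [e2] at h1
  -- The phase rotates by `-b log n` at each step; conjugation turns this into the positive rotation
  -- treated above.
  have hterm : ∀ k : ℕ, (n : ℂ) ^ (-(1 / 2 + Complex.I * ((a + (k : ℝ) * b : ℝ) : ℂ))) =
      (n : ℂ) ^ (-(1 / 2 + Complex.I * a)) *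
        (starRingEnd ℂ) (Complex.exp (Complex.I * ((b * Real.log n : ℝ) : ℂ)) ^ k) := by
    intro k
    rw [map_pow, ← Complex.exp_conj, ← Complex.exp_nat_mul, map_mul, Complex.conj_I,
      Complex.conj_ofReal, Complex.cpow_def_of_ne_zero hn0, Complex.cpow_def_of_ne_zero hn0,
      ← Complex.exp_add, ← Complex.natCast_log]
    congr 1
    push_cast; ring
  simp_rw [hterm]
  rw [← mul_sum, ← map_sum, norm_mul, RCLike.norm_conj, mul_comm]
  have hnorm : ‖(n : ℂ) ^ (-(1 / 2 + Complex.I * a))‖ = (√n)⁻¹ := by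
    rw [Complex.norm_natCast_cpow_of_pos hn, Real.sqrt_eq_rpow, ← Real.rpow_neg (by positivity)]
    simp
  rw [hnorm]
  exact mul_le_mul_of_nonneg_right h1 (by positivity)

/-- If `m` is the least element of the window, all others are at most `m e^δ ≤ m(1 + 2δ)`, so there
are at most `1 + 2δm` terms, each at most `1/√m`. -/
lemma sum_fiber_inv_sqrt_le {δ : ℝ} (h0 : 0 < δ) (h1 : δ ≤ 1) {y N : ℕ} (hy : 1 ≤ y) (v : ℕ) :
    ∑ n ∈ (Ioc y N).filter (fun n : ℕ => ⌊Real.log n / δ⌋₊ = v), (√(n : ℝ))⁻¹ ≤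
      (√y)⁻¹ + 2 * δ * √N := by
  set S := (Ioc y N).filter (fun n : ℕ => ⌊Real.log n / δ⌋₊ = v) with hS
  rcases S.eq_empty_or_nonempty with h | h
  · rw [h, sum_empty]; positivity
  set m := S.min' h
  have hmS : m ∈ S := S.min'_mem h
  have hmem := mem_filter.1 hmS
  have hmy := mem_Ioc.1 hmem.1
  have hm1 : (1 : ℝ) ≤ m := by exact_mod_cast (hy.trans hmy.1.le)
  have hsub : S ⊆ Icc m (m + ⌊2 * δ * m⌋₊) := by
    intro n hn
    have hmn : m ≤ n := S.min'_le _ hn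
    have hnr : (m : ℝ) ≤ n := by exact_mod_cast hmn
    have hnm := mem_filter.1 hn
    refine mem_Icc.2 ⟨hmn, ?_⟩
    have hl : Real.log n / δ < Real.log m / δ + 1 := by
      have ha := Nat.lt_floor_add_one (Real.log n / δ)
      have hb := Nat.floor_le (a := Real.log m / δ)
        (div_nonneg (Real.log_natCast_nonneg m) h0.le)
      rw [hnm.2] at ha
      rw [hmem.2] at hb
      linarith
    have hl2 : Real.log n < Real.log m + δ := by
      rw [div_add_one h0.ne', div_lt_div_iff_of_pos_right h0] at hl
      exact hl
    have hl3 : (n : ℝ) ≤ m * Real.exp δ := by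
      rw [← Real.log_le_log_iff (by linarith) (by positivity),
        Real.log_mul (by positivity) (by positivity), Real.log_exp]
      exact hl2.le
    have he : Real.exp δ ≤ 1 + 2 * δ := by
      have := Real.abs_exp_sub_one_le (x := δ) (by rwa [abs_of_pos h0])
      rw [abs_of_pos h0] at this
      linarith [le_abs_self (Real.exp δ - 1)]
    have : ((n - m : ℕ) : ℝ) ≤ 2 * δ * m := by
      rw [Nat.cast_sub hmn]; nlinarith
    have := Nat.le_floor this
    omega
  have hcard : (S.card : ℝ) ≤ 1 + 2 * δ * m := by
    have h2 := card_le_card hsub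
    rw [Nat.card_Icc] at h2
    have h3 : (S.card : ℝ) ≤ 1 + (⌊2 * δ * m⌋₊ : ℝ) := by
      have : S.card ≤ 1 + ⌊2 * δ * m⌋₊ := by omega
      exact_mod_cast this
    linarith [Nat.floor_le (show 0 ≤ 2 * δ * m by positivity)]
  have hs := sum_le_card_nsmul S (fun n : ℕ => (√(n : ℝ))⁻¹) ((√m)⁻¹) fun n hn => by
    have : (m : ℝ) ≤ n := by exact_mod_cast S.min'_le _ hn
    exact inv_anti₀ (Real.sqrt_pos.2 (by linarith)) (Real.sqrt_le_sqrt this)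
  refine hs.trans ?_
  rw [nsmul_eq_mul]
  have hsq : 0 < √(m : ℝ) := Real.sqrt_pos.2 (by linarith)
  have hmm : (m : ℝ) * (√(m : ℝ))⁻¹ = √m := by
    rw [← div_eq_mul_inv, Real.div_sqrt]
  calc _ ≤ (1 + 2 * δ * m) * (√m)⁻¹ := mul_le_mul_of_nonneg_right hcard (by positivity)
    _ = (√m)⁻¹ + 2 * δ * √m := by rw [add_mul, one_mul, mul_assoc, hmm]
    _ ≤ _ := by
      refine add_le_add (inv_anti₀ (Real.sqrt_pos.2 (by exact_mod_cast hy))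
        (Real.sqrt_le_sqrt (by exact_mod_cast hmy.1.le))) ?_
      exact mul_le_mul_of_nonneg_left (Real.sqrt_le_sqrt (by exact_mod_cast hmy.2)) (by positivity)

/-- Averaging `n^{-s}` over an arithmetic progression on the critical line. -/
lemma sum_norm_sum_cpow_progression_le {K : ℕ} (hK : 0 < K) (a : ℝ) {b : ℝ} (hb : 0 < b)
    (hKb : 2 * Real.pi ≤ K * b) {y N : ℕ} (hy : 1 ≤ y) (hN : 1 ≤ N) :
    ∑ n ∈ Ioc y N,
      ‖∑ k ∈ Icc 1 K, (n : ℂ) ^ (-(1 / 2 + Complex.I * ((a + (k : ℝ) * b : ℝ) : ℂ)))‖ ≤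
      K * ((b * Real.log N + 1) * (2 * (1 + Real.log K)) * ((√y)⁻¹ + 13 * √N / (K * b))) := by
  have hpi := Real.pi_pos
  have hpi3 := Real.pi_gt_three
  have hKr : (0 : ℝ) < K := by exact_mod_cast hK
  -- A window of length `δ` in `log n` is one of the `K` arcs for the phase `b log n`; `J` below
  -- bounds the number of turns up to `N`.
  set δ : ℝ := 2 * Real.pi / (K * b) with hδ
  have hδ0 : 0 < δ := by positivity
  have hδ1 : δ ≤ 1 := by rw [hδ, div_le_one (by positivity)]; exact hKb
  set J := ⌊b * Real.log N / (2 * Real.pi)⌋₊ + 1 with hJ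
  have hlogN : 0 ≤ Real.log N := Real.log_natCast_nonneg N
  have hJle : (J : ℝ) ≤ b * Real.log N + 1 := by
    rw [hJ]; push_cast
    have h1 := Nat.floor_le (a := b * Real.log N / (2 * Real.pi)) (by positivity)
    have h2 : b * Real.log N / (2 * Real.pi) ≤ b * Real.log N :=
      div_le_self (by positivity) (by linarith)
    linarith
  have hveq : ∀ n : ℕ, K * (b * Real.log n / (2 * Real.pi)) = Real.log n / δ := fun n => by
    rw [hδ]; field_simp
  set B := (√y)⁻¹ + 2 * δ * √N
  have hmaps : ∀ n ∈ Ioc y N, ⌊Real.log n / δ⌋₊ ∈ range (K * J) := by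
    intro n hn
    rw [mem_Ioc] at hn
    have hnr : (0 : ℝ) < n := by exact_mod_cast (by omega : 0 < n)
    have h1 : Real.log n ≤ Real.log N := Real.log_le_log hnr (by exact_mod_cast hn.2)
    rw [mem_range, Nat.floor_lt (div_nonneg (Real.log_natCast_nonneg n) hδ0.le), ← hveq]
    push_cast
    refine mul_lt_mul_of_pos_left ?_ hKr
    have h2 := Nat.lt_floor_add_one (b * Real.log N / (2 * Real.pi))
    rw [hJ]; push_cast
    refine lt_of_le_of_lt ?_ h2
    gcongr
  calc _ ≤ ∑ n ∈ Ioc y N, K * arcWeight K (⌊Real.log n / δ⌋₊ % K) * (√n)⁻¹ := by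
        refine sum_le_sum fun n hn => ?_
        rw [← hveq]
        exact norm_sum_cpow_progression_le hK a hb (by rw [mem_Ioc] at hn; omega)
    _ = ∑ v ∈ range (K * J), ∑ n ∈ (Ioc y N).filter (fun n : ℕ => ⌊Real.log n / δ⌋₊ = v),
          K * arcWeight K (⌊Real.log n / δ⌋₊ % K) * (√n)⁻¹ :=
        (sum_fiberwise_of_maps_to hmaps _).symm
    _ = ∑ v ∈ range (K * J), K * arcWeight K (v % K) *
          ∑ n ∈ (Ioc y N).filter (fun n : ℕ => ⌊Real.log n / δ⌋₊ = v), (√(n : ℝ))⁻¹ := by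
        refine sum_congr rfl fun v _ => ?_
        rw [mul_sum]
        refine sum_congr rfl fun n hn => ?_
        rw [(mem_filter.1 hn).2]
    _ ≤ ∑ v ∈ range (K * J), K * arcWeight K (v % K) * B := by
        refine sum_le_sum fun v _ => mul_le_mul_of_nonneg_left
          (sum_fiber_inv_sqrt_le hδ0 hδ1 hy v) ?_
        exact mul_nonneg hKr.le (arcWeight_nonneg (Nat.mod_lt _ hK))
    _ = K * (J * (∑ i ∈ range K, arcWeight K i) * B) := by
        rw [sum_range_mul_eq]
        have : ∀ j ∈ range J, ∑ r ∈ range K, K * arcWeight K ((K * j + r) % K) * B =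
            K * ((∑ i ∈ range K, arcWeight K i) * B) := by
          intro j _
          rw [sum_mul, mul_sum]
          refine sum_congr rfl fun r hr => ?_
          rw [Nat.mul_add_mod, Nat.mod_eq_of_lt (mem_range.1 hr)]
          ring
        rw [sum_congr rfl this, sum_const, card_range, nsmul_eq_mul]
        ring
    _ ≤ _ := by
        have hB : B ≤ (√y)⁻¹ + 13 * √N / (K * b) := by
          refine add_le_add le_rfl ?_
          have : 2 * δ * √N = (4 * Real.pi) * √N / (K * b) := by rw [hδ]; ring
          rw [this]
          have := Real.pi_lt_d2
          gcongr
          linarith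
        have hA := sum_arcWeight_le K
        have hA0 : 0 ≤ ∑ i ∈ range K, arcWeight K i :=
          sum_nonneg fun i hi => arcWeight_nonneg (mem_range.1 hi)
        gcongr
end

/-! ### Mollification and the first moment -/

section
open Finset

/-- For `l ≤ y < N` every factorization of `l` lies inside the box of summation, so Möbius inversion
is exact and only `l = 1` survives. Beyond `y` the convolution is incomplete, but still at most
`d(l)`. -/
lemma exists_mollified_coeff {q : ℕ} (χ : DirichletCharacter ℂ q) {y N : ℕ}
    (hy : 1 ≤ y) (hyN : y < N) : ∃ c : ℕ → ℂ, (∀ l, ‖c l‖ ≤ l.divisors.card) ∧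
      ∀ s : ℂ, s ≠ 0 →
        (∑ m ∈ Ioc 0 y, (ArithmeticFunction.moebius m : ℂ) * (χ (m : ZMod q) * (m : ℂ) ^ (-s))) *
          (∑ n ∈ range N, χ (n : ZMod q) * (n : ℂ) ^ (-s)) =
        1 + ∑ l ∈ Ioc y (y * N), c l * (l : ℂ) ^ (-s) := by
  classical
  set S : Finset (ℕ × ℕ) := Ioc 0 y ×ˢ Ico 1 N with hS
  set d : ℕ → ℂ := fun l => ∑ p ∈ S.filter (fun p => p.1 * p.2 = l),
    (ArithmeticFunction.moebius p.1 : ℂ) with hd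
  have hsub : ∀ l, S.filter (fun p => p.1 * p.2 = l) ⊆ l.divisorsAntidiagonal := by
    intro l p hp
    rw [mem_filter, hS, mem_product, mem_Ioc, mem_Ico] at hp
    rw [Nat.mem_divisorsAntidiagonal]
    refine ⟨hp.2, ?_⟩
    rw [← hp.2]
    exact Nat.mul_ne_zero (by omega) (by omega)
  have hdl : ∀ l, ‖d l‖ ≤ l.divisors.card := by
    intro l
    have h1 : ‖d l‖ ≤ ∑ p ∈ S.filter (fun p => p.1 * p.2 = l), (1 : ℝ) := by
      refine norm_sum_le_of_le _ fun p _ => ?_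
      rw [Complex.norm_intCast]
      exact_mod_cast ArithmeticFunction.abs_moebius_le_one
    refine h1.trans ?_
    rw [sum_const, nsmul_one]
    have h2 := card_le_card (hsub l)
    rw [← Nat.map_div_right_divisors, card_map] at h2
    exact_mod_cast h2
  have hdy : ∀ l ∈ Ioc 0 y, d l = if l = 1 then 1 else 0 := by
    intro l hl
    rw [mem_Ioc] at hl
    have heq : S.filter (fun p => p.1 * p.2 = l) = l.divisorsAntidiagonal := by
      refine (hsub l).antisymm fun p hp => ?_
      rw [Nat.mem_divisorsAntidiagonal] at hp
      have h1 : 0 < p.1 := Nat.pos_of_ne_zero (by rintro h; simp [h] at hp; omega)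
      have h2 : 0 < p.2 := Nat.pos_of_ne_zero (by rintro h; simp [h] at hp; omega)
      have h3 : p.1 ≤ l := by rw [← hp.1]; exact Nat.le_mul_of_pos_right _ h2
      have h4 : p.2 ≤ l := by rw [← hp.1]; exact Nat.le_mul_of_pos_left _ h1
      rw [mem_filter, hS, mem_product, mem_Ioc, mem_Ico]
      exact ⟨⟨⟨h1, by omega⟩, h2, by omega⟩, hp.1⟩
    have h := congrArg (fun f : ArithmeticFunction ℤ => f l) ArithmeticFunction.moebius_mul_coe_zeta
    simp only [ArithmeticFunction.mul_apply, ArithmeticFunction.one_apply] at h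
    have h5 : ∑ p ∈ l.divisorsAntidiagonal, ArithmeticFunction.moebius p.1 =
        if l = 1 then 1 else 0 := by
      rw [← h]
      refine sum_congr rfl fun p hp => ?_
      have : p.2 ≠ 0 := by
        rintro h0
        rw [Nat.mem_divisorsAntidiagonal, h0] at hp
        omega
      simp [ArithmeticFunction.zeta_apply, this]
    rw [hd]
    simp only [heq]
    have h6 := congrArg (fun t : ℤ => (t : ℂ)) h5
    push_cast at h6
    exact h6
  refine ⟨fun l => d l * χ (l : ZMod q), fun l => ?_, fun s hs => ?_⟩
  · rw [norm_mul]
    exact (mul_le_of_le_one_right (norm_nonneg _) (DirichletCharacter.norm_le_one χ _)).trans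
      (hdl l)
  have h0 : ∑ n ∈ range N, χ (n : ZMod q) * (n : ℂ) ^ (-s) =
      ∑ n ∈ Ico 1 N, χ (n : ZMod q) * (n : ℂ) ^ (-s) := by
    rw [range_eq_Ico, sum_eq_sum_Ico_succ_bot (by omega)]
    simp [hs]
  have hmaps : ∀ p ∈ S, p.1 * p.2 ∈ Ioc 0 (y * N) := by
    intro p hp
    rw [hS, mem_product, mem_Ioc, mem_Ico] at hp
    rw [mem_Ioc]
    exact ⟨Nat.mul_pos hp.1.1 hp.2.1, Nat.mul_le_mul hp.1.2 hp.2.2.le⟩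
  rw [h0, sum_mul_sum, ← sum_product', ← sum_fiberwise_of_maps_to hmaps]
  have h1 : ∀ l ∈ Ioc 0 (y * N), ∑ p ∈ S.filter (fun p => p.1 * p.2 = l),
      (ArithmeticFunction.moebius p.1 : ℂ) * (χ (p.1 : ZMod q) * (p.1 : ℂ) ^ (-s)) *
        (χ (p.2 : ZMod q) * (p.2 : ℂ) ^ (-s)) = d l * χ (l : ZMod q) * (l : ℂ) ^ (-s) := by
    intro l _
    rw [hd, mul_assoc, sum_mul]
    refine sum_congr rfl fun p hp => ?_
    rw [← (mem_filter.1 hp).2, Nat.cast_mul, map_mul, Nat.cast_mul, Complex.natCast_mul_natCast_cpow]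
    ring
  rw [sum_congr rfl h1]
  have h2 : Ioc 0 (y * N) = Ioc 0 y ∪ Ioc y (y * N) :=
    (Ioc_union_Ioc_eq_Ioc (by omega) (Nat.le_mul_of_pos_right _ (by omega))).symm
  have h3 : Disjoint (Ioc 0 y) (Ioc y (y * N)) := by
    rw [disjoint_left]; intro a ha hb; rw [mem_Ioc] at ha hb; omega
  rw [h2, sum_union h3]
  congr 1
  rw [sum_eq_single 1]
  · rw [hdy 1 (by rw [mem_Ioc]; omega)]; simp
  · intro l hl hl1
    rw [hdy l hl, if_neg hl1]; simp
  · intro h; exact absurd (mem_Ioc.2 ⟨one_pos, hy⟩) h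

lemma sum_inv_sqrt_le (y : ℕ) : ∑ m ∈ Ioc 0 y, (√(m : ℝ))⁻¹ ≤ 2 * √y := by
  induction y with
  | zero => simp
  | succ y ih =>
    rw [← Order.succ_eq_add_one, ← insert_Ioc_right_eq_Ioc_succ (by omega), sum_insert (by simp)]
    rw [Order.succ_eq_add_one]
    push_cast
    have h1 : 0 < √((y : ℝ) + 1) := Real.sqrt_pos.2 (by positivity)
    have h2 := Real.sq_sqrt (show (0 : ℝ) ≤ y + 1 by positivity)
    have h3 := Real.sq_sqrt (show (0 : ℝ) ≤ y by positivity)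
    have h4 := Real.sqrt_nonneg (y : ℝ)
    have h5 : (√((y : ℝ) + 1))⁻¹ ≤ 2 * (√((y : ℝ) + 1) - √y) := by
      rw [inv_le_iff_one_le_mul₀ h1]
      nlinarith [sq_nonneg (√((y : ℝ) + 1) - √y)]
    linarith

/-- If `L` vanishes along the progression, the mollified first moment gives this inequality. -/
lemma one_le_of_forall_LFunction_eq_zero {A : ℝ}
    (hAFE : ∀ (q : ℕ) [NeZero q] (χ : DirichletCharacter ℂ q), χ ≠ 1 → ∀ s : ℂ, s.re = 1 / 2 →
      ∀ M : ℕ, 1 ≤ M → 2 * ‖s‖ ≤ M →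
        ‖DirichletCharacter.LFunction χ s -
          ∑ n ∈ range (q * M), χ (n : ZMod q) * (n : ℂ) ^ (-s)‖ ≤ A * √(q / M))
    {q : ℕ} [NeZero q] {χ : DirichletCharacter ℂ q} (hχ : χ ≠ 1) {a b : ℝ} (ha : 0 ≤ a)
    (hab : a < b) {K M y : ℕ} (hK : 0 < K) (hKb : 2 * Real.pi ≤ K * b)
    (hM : 1 + 2 * ((K : ℝ) + 1) * b ≤ M) (hy : 1 ≤ y) (hyM : y < q * M) {Δ : ℝ}
    (hΔ : ∀ l ∈ Ioc y (y * (q * M)), (l.divisors.card : ℝ) ≤ Δ)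
    (hL : ∀ k ∈ Icc 1 K,
      DirichletCharacter.LFunction χ (1 / 2 + Complex.I * ((a + (k : ℝ) * b : ℝ) : ℂ)) = 0) :
    1 ≤ 2 * √y * (A * √(q / M)) +
      Δ * ((b * Real.log (y * (q * M) : ℕ) + 1) * (2 * (1 + Real.log K)) *
        ((√y)⁻¹ + 13 * √(y * (q * M) : ℕ) / (K * b))) := by
  have hb : 0 < b := ha.trans_lt hab
  have hKr : (0 : ℝ) < K := by exact_mod_cast hK
  obtain ⟨c, hc, hprod⟩ := exists_mollified_coeff χ hy hyM
  set s : ℕ → ℂ := fun k => 1 / 2 + Complex.I * ((a + (k : ℝ) * b : ℝ) : ℂ) with hs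
  have hre : ∀ k, (s k).re = 1 / 2 := fun k => by simp [hs]
  have hs0 : ∀ k, s k ≠ 0 := fun k h => by
    have := hre k
    rw [h] at this; norm_num at this
  have hM1 : (1 : ℝ) ≤ M := by
    have : 0 ≤ 2 * ((K : ℝ) + 1) * b := by positivity
    linarith
  -- Here `a < b` enters: it places the whole progression below height `(K + 1)b`.
  have hnorm : ∀ k ∈ Icc 1 K, 2 * ‖s k‖ ≤ M := by
    intro k hk
    have hkK : (k : ℝ) ≤ K := by exact_mod_cast (mem_Icc.1 hk).2
    refine le_trans ?_ hM
    have h1 : ‖s k‖ ≤ 1 / 2 + (a + k * b) := by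
      refine (norm_add_le _ _).trans (add_le_add (by simp) ?_)
      rw [norm_mul, Complex.norm_I, one_mul, Complex.norm_real, Real.norm_of_nonneg (by positivity)]
    have h2 : (k : ℝ) * b ≤ K * b := mul_le_mul_of_nonneg_right hkK hb.le
    linarith
  set mol : ℂ → ℂ := fun z =>
    ∑ m ∈ Ioc 0 y, (ArithmeticFunction.moebius m : ℂ) * (χ (m : ZMod q) * (m : ℂ) ^ (-z)) with hmol
  have hmolb : ∀ k, ‖mol (s k)‖ ≤ 2 * √y := by
    intro k
    refine (norm_sum_le_of_le (n := fun m : ℕ => (√(m : ℝ))⁻¹) _ fun m hm => ?_).trans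
      (sum_inv_sqrt_le y)
    have hm1 : 0 < m := (mem_Ioc.1 hm).1
    have e1 : ‖(ArithmeticFunction.moebius m : ℂ)‖ ≤ 1 := by
      rw [Complex.norm_intCast]
      exact_mod_cast ArithmeticFunction.abs_moebius_le_one
    have e2 : ‖(m : ℂ) ^ (-s k)‖ = (√(m : ℝ))⁻¹ := by
      rw [Complex.norm_natCast_cpow_of_pos hm1, Complex.neg_re, hre, Real.sqrt_eq_rpow,
        Real.rpow_neg (by positivity)]
    rw [norm_mul, norm_mul, e2]
    have e3 := DirichletCharacter.norm_le_one χ (m : ZMod q)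
    exact (mul_le_of_le_one_left (by positivity) e1).trans
      (mul_le_of_le_one_left (by positivity) e3)
  have hpoint : ∀ k ∈ Icc 1 K, ‖mol (s k) * ∑ n ∈ range (q * M), χ (n : ZMod q) * (n : ℂ) ^ (-s k)‖
      ≤ 2 * √y * (A * √(q / M)) := by
    intro k hk
    have h1 := hAFE q χ hχ (s k) (hre k) M (by exact_mod_cast hM1) (hnorm k hk)
    rw [hL k hk, zero_sub, norm_neg] at h1
    rw [norm_mul]
    exact mul_le_mul (hmolb k) h1 (norm_nonneg _) (by positivity)
  have hident : (K : ℂ) = ∑ k ∈ Icc 1 K, mol (s k) *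
      (∑ n ∈ range (q * M), χ (n : ZMod q) * (n : ℂ) ^ (-s k)) -
      ∑ l ∈ Ioc y (y * (q * M)), c l * ∑ k ∈ Icc 1 K, (l : ℂ) ^ (-s k) := by
    have : ∑ k ∈ Icc 1 K, mol (s k) *
      (∑ n ∈ range (q * M), χ (n : ZMod q) * (n : ℂ) ^ (-s k)) =
        ∑ k ∈ Icc 1 K, (1 + ∑ l ∈ Ioc y (y * (q * M)), c l * (l : ℂ) ^ (-s k)) :=
      sum_congr rfl fun k _ => hprod (s k) (hs0 k)
    rw [this, sum_add_distrib, sum_comm]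
    simp [mul_sum]
  have hΔ0 : 0 ≤ Δ := by
    refine le_trans (Nat.cast_nonneg _) (hΔ (y + 1) (mem_Ioc.2 ⟨by omega, ?_⟩))
    nlinarith
  have hfirst : ‖∑ k ∈ Icc 1 K, mol (s k) *
      (∑ n ∈ range (q * M), χ (n : ZMod q) * (n : ℂ) ^ (-s k))‖ ≤
      K * (2 * √y * (A * √(q / M))) :=
    (norm_sum_le_of_le _ hpoint).trans_eq (by simp)
  have hsecond : ‖∑ l ∈ Ioc y (y * (q * M)), c l * ∑ k ∈ Icc 1 K, (l : ℂ) ^ (-s k)‖ ≤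
      Δ * (K * ((b * Real.log (y * (q * M) : ℕ) + 1) * (2 * (1 + Real.log K)) *
        ((√y)⁻¹ + 13 * √(y * (q * M) : ℕ) / (K * b)))) := by
    refine (norm_sum_le_of_le (n := fun l : ℕ => Δ * ‖∑ k ∈ Icc 1 K, (l : ℂ) ^ (-s k)‖) _
      fun l hl => ?_).trans ?_
    · rw [norm_mul]
      exact mul_le_mul_of_nonneg_right ((hc l).trans (hΔ l hl)) (norm_nonneg _)
    · rw [← mul_sum]
      refine mul_le_mul_of_nonneg_left ?_ hΔ0
      exact sum_norm_sum_cpow_progression_le hK a hb hKb hy (by nlinarith)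
  have hfinal : (K : ℝ) * 1 ≤ K * (2 * √y * (A * √(q / M)) +
      Δ * ((b * Real.log (y * (q * M) : ℕ) + 1) * (2 * (1 + Real.log K)) *
        ((√y)⁻¹ + 13 * √(y * (q * M) : ℕ) / (K * b)))) := by
    calc (K : ℝ) * 1 = ‖(K : ℂ)‖ := by simp
      _ ≤ _ := by rw [hident]; exact norm_sub_le _ _
      _ ≤ _ := add_le_add hfirst hsecond
      _ = _ := by rw [mul_left_comm Δ, ← mul_add]
  exact le_of_mul_le_mul_left hfinal hKr
end

/-! ### Growth estimates -/

section
open Filter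

lemma tendsto_div_log_atTop : Tendsto (fun x : ℝ => x / Real.log x) atTop atTop := by
  have h := (isLittleO_log_rpow_atTop one_pos).tendsto_div_nhds_zero
  have h2 : Tendsto (fun x : ℝ => Real.log x / x ^ (1 : ℝ)) atTop (nhdsWithin 0 (Set.Ioi 0)) := by
    refine tendsto_nhdsWithin_iff.2 ⟨h, ?_⟩
    filter_upwards [eventually_gt_atTop 1] with x hx
    exact div_pos (Real.log_pos hx) (by positivity)
  refine h2.inv_tendsto_nhdsGT_zero.congr fun x => ?_
  simp

lemma eventually_rpow_mul_log_le {δ κ : ℝ} (hδ : 0 < δ) (hκ : 0 < κ) :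
    ∀ᶠ x : ℝ in atTop, x ^ (1 - δ) * (3 * Real.log x) ≤ κ * (x / Real.log x) := by
  have h := (isLittleO_log_rpow_atTop (half_pos hδ)).bound
    (show 0 < √(κ / 3) from Real.sqrt_pos.2 (by positivity))
  filter_upwards [h, eventually_gt_atTop 1] with x hx hx1
  have hl := Real.log_pos hx1
  have hx0 : 0 < x := by linarith
  rw [Real.norm_of_nonneg hl.le, Real.norm_of_nonneg (by positivity)] at hx
  have h2 : Real.log x ^ 2 ≤ κ / 3 * x ^ δ := by
    calc _ ≤ (√(κ / 3) * x ^ (δ / 2)) ^ 2 := pow_le_pow_left₀ hl.le hx 2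
      _ = _ := by
        rw [mul_pow, Real.sq_sqrt (by positivity), ← Real.rpow_natCast, ← Real.rpow_mul hx0.le]
        norm_num
  rw [← mul_div_assoc, le_div_iff₀ hl]
  have h3 : x ^ (1 - δ) * x ^ δ = x := by
    rw [← Real.rpow_add hx0]; simp
  calc _ = x ^ (1 - δ) * (3 * Real.log x ^ 2) := by ring
    _ ≤ x ^ (1 - δ) * (3 * (κ / 3 * x ^ δ)) := by gcongr
    _ = κ * (x ^ (1 - δ) * x ^ δ) := by ring
    _ = _ := by rw [h3]

/-- The growth estimates that tie the divisor bound to the length of the progression. -/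
lemma exists_eventually_growth {D A : ℝ} (hD : 8 * Real.log 2 < D) :
    ∃ δ : ℝ, 0 < δ ∧ δ < 1 ∧ ∀ᶠ x : ℝ in atTop,
      9 + 3 / 2 * (D * x / Real.log x) ≤ δ * x ∧ D * x / Real.log x ≤ x ∧
      64 * A ≤ Real.exp (D * x / Real.log x / 4) / 4 ∧
      (1 + 2 * (3 * x)) ^ (x ^ (1 - δ)) * (2 : ℝ) ^ ((2 + δ) * x / Real.log (x ^ (1 - δ))) *
        ((1 + 3 * x) * (2 * (1 + 2 * x)) * 1100) ≤ Real.exp (D * x / Real.log x / 4) / 4 := by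
  have hlog2 := Real.log_pos one_lt_two
  have hD0 : 0 < D := by linarith
  -- Half of the value at which `log 2 · (2 + δ)/(1 - δ)` reaches `D/4`; it is positive because `D >
  -- 8 log 2`.
  set δ : ℝ := (D / 4 - 2 * Real.log 2) / (2 * (Real.log 2 + D / 4)) with hδ
  have hden : 0 < 2 * (Real.log 2 + D / 4) := by positivity
  have hδ0 : 0 < δ := div_pos (by linarith) hden
  have hδ1 : δ < 1 := by rw [hδ, div_lt_one hden]; linarith
  have hδe : δ * (2 * (Real.log 2 + D / 4)) = D / 4 - 2 * Real.log 2 := by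
    rw [hδ]; field_simp
  set c := Real.log 2 * (2 + δ) / (1 - δ) with hc
  have hcD : c < D / 4 := by
    rw [hc, div_lt_iff₀ (by linarith)]
    nlinarith
  refine ⟨δ, hδ0, hδ1, ?_⟩
  have hX := tendsto_div_log_atTop
  have e1 : ∀ᶠ x : ℝ in atTop, 3 / 2 * D + 1 ≤ Real.log x * (δ / 2) :=
    (Real.tendsto_log_atTop.atTop_mul_const (half_pos hδ0)).eventually_ge_atTop _
  have e2 : ∀ᶠ x : ℝ in atTop, D ≤ Real.log x := Real.tendsto_log_atTop.eventually_ge_atTop _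
  have e3 : ∀ᶠ x : ℝ in atTop, 256 * A ≤ Real.exp (D / 4 * (x / Real.log x)) :=
    (Real.tendsto_exp_atTop.comp (hX.const_mul_atTop (by positivity))).eventually_ge_atTop _
  -- The gap `D/4 - c` is halved: one half pays for the small primes in the divisor bound, the other
  -- for the powers of `x`.
  have e4 := eventually_rpow_mul_log_le hδ0 (show 0 < (D / 4 - c) / 2 by linarith)
  filter_upwards [e1, e2, e3, e4, eventually_ge_atTop (100000 : ℝ), eventually_ge_atTop (18 / δ)]
    with x h1 h2 h3 h4 hx hx2
  have hx0 : 0 < x := by linarith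
  have hl : 0 < Real.log x := Real.log_pos (by linarith)
  have hX : D * x / Real.log x / 4 = D / 4 * (x / Real.log x) := by ring
  refine ⟨?_, ?_, ?_, ?_⟩
  · have ha : 9 ≤ δ / 2 * x := by
      rw [div_le_iff₀ hδ0] at hx2; linarith
    have hb : 3 / 2 * (D * x / Real.log x) ≤ δ / 2 * x := by
      rw [← mul_div_assoc, div_le_iff₀ hl]
      nlinarith
    linarith
  · rw [div_le_iff₀ hl]
    nlinarith
  · rw [hX]; linarith
  · rw [hX]
    set X := x / Real.log x with hXdef
    have g1 : (1 + 2 * (3 * x)) ^ (x ^ (1 - δ)) ≤ Real.exp ((D / 4 - c) / 2 * X) := by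
      rw [Real.rpow_def_of_pos (by positivity)]
      refine Real.exp_le_exp.2 (le_trans ?_ h4)
      rw [mul_comm]
      refine mul_le_mul_of_nonneg_left ?_ (by positivity)
      rw [← Real.log_rpow hx0]
      refine Real.log_le_log (by positivity) ?_
      norm_num
      nlinarith [sq_nonneg x]
    have g2 : (2 : ℝ) ^ ((2 + δ) * x / Real.log (x ^ (1 - δ))) = Real.exp (c * X) := by
      rw [Real.rpow_def_of_pos two_pos, Real.log_rpow hx0, hc, hXdef]
      congr 1
      have : 1 - δ ≠ 0 := by linarith
      field_simp
    have g3 : 4 * ((1 + 3 * x) * (2 * (1 + 2 * x)) * 1100) ≤ Real.exp ((D / 4 - c) / 2 * X) := by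
      have : (1 : ℝ) ≤ x ^ (1 - δ) := Real.one_le_rpow (by linarith) (by linarith)
      have h5 : 3 * Real.log x ≤ (D / 4 - c) / 2 * X := by nlinarith
      refine le_trans ?_ (Real.exp_le_exp.2 h5)
      have h6 : Real.exp (3 * Real.log x) = x ^ 3 := by
        rw [mul_comm, Real.exp_mul, Real.exp_log hx0]; norm_cast
      rw [h6]
      nlinarith [mul_pos hx0 hx0]
    have g4 : Real.exp ((D / 4 - c) / 2 * X) * Real.exp (c * X) * Real.exp ((D / 4 - c) / 2 * X) =
        Real.exp (D / 4 * X) := by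
      rw [← Real.exp_add, ← Real.exp_add]; congr 1; ring
    rw [g2, ← g4]
    have : 0 < Real.exp (c * X) := Real.exp_pos _
    calc _ ≤ Real.exp ((D / 4 - c) / 2 * X) * Real.exp (c * X) *
          (Real.exp ((D / 4 - c) / 2 * X) / 4) := by
          gcongr
          linarith
      _ = _ := by ring
end

/-! ### Choice of parameters and conclusion -/

section
open Finset

-- The free scale `R` handles both ranges of `b` and may be raised to the threshold when `b³q` is
-- small. The slack `512 = 8³` serves the small-step case, where the enlarged step is at most 8.
set_option maxHeartbeats 400000 in
lemma exists_LFunction_ne_zero_of_one_le {D : ℝ} (hD : 8 * Real.log 2 < D) :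
    ∃ R₀ : ℝ, 1 ≤ R₀ ∧ ∀ R : ℝ, R₀ ≤ R →
      ∀ (q : ℕ) [NeZero q] (χ : DirichletCharacter ℂ q), χ ≠ 1 →
        ∀ a b : ℝ, 0 ≤ a → a < b → 1 ≤ b → b ^ 3 * q ≤ 512 * R →
          ∃ k : ℕ, 0 < k ∧
            (k : ℝ) ≤ R * Real.exp (D * Real.log R / Real.log (Real.log R)) ∧
            DirichletCharacter.LFunction χ
              (1 / 2 + Complex.I * ((a + (k : ℝ) * b : ℝ) : ℂ)) ≠ 0 := by
  obtain ⟨A₁, hA₁, hAFE₁⟩ := exists_norm_LFunction_sub_sum_le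
  set A := max A₁ 1 with hA
  have hA1 : 1 ≤ A := le_max_right _ _
  obtain ⟨δ, hδ0, hδ1, hev⟩ := exists_eventually_growth (A := A) hD
  obtain ⟨R₁, hR₁⟩ := Filter.eventually_atTop.1 (Real.tendsto_log_atTop.eventually
    (hev.and (Filter.eventually_gt_atTop 1)))
  refine ⟨max R₁ 1, le_max_right _ _, ?_⟩
  intro R hR q _ χ hχ a b ha hab hb hbq
  have hR1 : 1 ≤ R := (le_max_right _ _).trans hR
  obtain ⟨⟨g1, g2, g3, g4⟩, hx1⟩ := hR₁ R ((le_max_left _ _).trans hR)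
  set x := Real.log R with hx
  set X := D * x / Real.log x with hX
  set e := Real.exp (X / 4) with he
  have hx0 : 0 < x := by linarith
  have hR0 : 0 < R := by linarith
  have hb0 : 0 < b := by linarith
  have he256 : 256 ≤ e := by linarith
  have he0 : 0 < e := by linarith
  have hE : Real.exp X = e ^ 4 := by rw [he, ← Real.exp_nat_mul]; congr 1; push_cast; ring
  have hq1 : (1 : ℝ) ≤ q := by exact_mod_cast NeZero.one_le (n := q)
  by_contra! H
  have he4 : 256 ^ 4 ≤ e ^ 4 := pow_le_pow_left₀ (by norm_num) he256 4
  have he2 : 256 ^ 2 ≤ e ^ 2 := pow_le_pow_left₀ (by norm_num) he256 2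
  have hRe : 256 ^ 4 ≤ R * e ^ 4 :=
    he4.trans (le_mul_of_one_le_left (by positivity) hR1)
  have hb2 : 1 ≤ b ^ 2 := one_le_pow₀ hb
  have hbe : 256 ^ 2 ≤ b ^ 2 * e ^ 2 :=
    he2.trans (le_mul_of_one_le_left (by positivity) hb2)
  -- `K` is the permitted length, `y` makes `1/√y` of size `1/(be)`, and `M` is the least truncation
  -- covering the progression. Then `yq(be)²` is at most a constant times `Kb`, so both `√(q y/M)`
  -- and `√N/(Kb)` are of size `1/(be)`.
  set K := ⌊R * e ^ 4⌋₊ with hK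
  set y := ⌊b ^ 2 * e ^ 2⌋₊ with hy
  set M := ⌈1 + 2 * ((K : ℝ) + 1) * b⌉₊ with hM
  have hK1 : (K : ℝ) ≤ R * e ^ 4 := Nat.floor_le (by positivity)
  have hK2 : R * e ^ 4 ≤ 2 * K := by
    have := Nat.lt_floor_add_one (R * e ^ 4)
    rw [← hK] at this; linarith
  have hy1 : (y : ℝ) ≤ b ^ 2 * e ^ 2 := Nat.floor_le (by positivity)
  have hy2 : b ^ 2 * e ^ 2 ≤ 2 * y := by
    have := Nat.lt_floor_add_one (b ^ 2 * e ^ 2)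
    rw [← hy] at this; linarith
  have hKr : (1 : ℝ) ≤ K := by linarith
  have hyr : (1 : ℝ) ≤ y := by linarith
  have hK0 : 0 < K := by exact_mod_cast (by linarith : (0 : ℝ) < K)
  have hKb1 : (K : ℝ) ≤ K * b := le_mul_of_one_le_right (by linarith) hb
  have hKb2 : b ≤ K * b := le_mul_of_one_le_left hb0.le hKr
  have hKb3 : 2 * ((K : ℝ) + 1) * b = 2 * (K * b) + 2 * b := by ring
  have hKb0 : 0 < (K : ℝ) * b := by linarith
  have hM1 : 1 + 2 * ((K : ℝ) + 1) * b ≤ M := Nat.le_ceil _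
  have hM2 : (M : ℝ) ≤ 6 * (K * b) := by
    have := Nat.ceil_lt_add_one (show 0 ≤ 1 + 2 * ((K : ℝ) + 1) * b by positivity)
    rw [← hM] at this
    linarith
  have hM3 : (K : ℝ) * b ≤ M := by linarith
  have hM0 : (0 : ℝ) < M := by linarith
  have hyq : (y : ℝ) * q * (b * e) ^ 2 ≤ 1024 * (K * b) := by
    calc (y : ℝ) * q * (b * e) ^ 2 ≤ (b ^ 2 * e ^ 2) * q * (b * e) ^ 2 := by gcongr
      _ = b * (b ^ 3 * q) * e ^ 4 := by ring
      _ ≤ b * (512 * R) * e ^ 4 := by gcongr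
      _ = 512 * b * (R * e ^ 4) := by ring
      _ ≤ 512 * b * (2 * K) := by gcongr
      _ = _ := by ring
  have hyM : y < q * M := by
    have h1 : (y : ℝ) * 1 * 65536 ≤ y * q * (b * e) ^ 2 := by
      rw [mul_pow]
      gcongr
      linarith
    have h2 : (y : ℝ) < M := by linarith
    have h3 : y < M := by exact_mod_cast h2
    exact h3.trans_le (Nat.le_mul_of_pos_left _ (NeZero.pos q))
  have hKpi : 2 * Real.pi ≤ K * b := by linarith [Real.pi_lt_d2]
  have hbe0 : 0 < b * e := by positivity
  set N := y * (q * M) with hN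
  have hN1 : 1 ≤ N := by
    have h1 : 0 < y := by exact_mod_cast (by linarith : (0 : ℝ) < y)
    have h2 : 0 < M := by exact_mod_cast hM0
    exact Nat.mul_pos h1 (Nat.mul_pos (NeZero.pos q) h2)
  have hNr : (N : ℝ) = y * q * M := by rw [hN]; push_cast; ring
  have hNle : (N : ℝ) ≤ 3072 * R ^ 2 * e ^ 6 := by
    rw [hNr]
    calc (y : ℝ) * q * M ≤ (b ^ 2 * e ^ 2) * q * (6 * ((R * e ^ 4) * b)) := by
          gcongr
          exact hM2.trans (by gcongr)
      _ = 6 * (b ^ 3 * q) * R * e ^ 6 := by ring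
      _ ≤ 6 * (512 * R) * R * e ^ 6 := by gcongr
      _ = _ := by ring
  -- The powers of `e` are `R^{o(1)}`, so they and the constant `3072` fit into `δx`.
  have hlogN : Real.log N ≤ (2 + δ) * x := by
    have h1 := Real.log_le_log (by exact_mod_cast hN1) hNle
    rw [Real.log_mul (by positivity) (by positivity), Real.log_mul (by norm_num) (by positivity),
      Real.log_pow, Real.log_pow, he, Real.log_exp, ← hx] at h1
    have h2 : Real.log 3072 ≤ 9 := by
      rw [Real.log_le_iff_le_exp (by norm_num)]
      have h3 : Real.exp 9 = Real.exp 1 ^ 9 := by rw [← Real.exp_nat_mul]; norm_num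
      rw [h3]
      have h4 : (2.7 : ℝ) ^ 9 ≤ Real.exp 1 ^ 9 :=
        pow_le_pow_left₀ (by norm_num) (by linarith [Real.exp_one_gt_d9]) 9
      refine le_trans ?_ h4
      norm_num
    push_cast at h1
    linarith
  have hlogN3 : Real.log N ≤ 3 * x := hlogN.trans (mul_le_mul_of_nonneg_right (by linarith) hx0.le)
  have hlogN0 : 0 ≤ Real.log N := Real.log_natCast_nonneg N
  have hlogK : Real.log K ≤ 2 * x := by
    have h1 := Real.log_le_log (by linarith) hK1
    rw [Real.log_mul (by positivity) (by positivity), ← hE, Real.log_exp, ← hx] at h1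
    linarith
  have hlogK0 : 0 ≤ Real.log K := Real.log_natCast_nonneg K
  have hz : 1 < x ^ (1 - δ) := Real.one_lt_rpow hx1 (by linarith)
  have hlogz : 0 < Real.log (x ^ (1 - δ)) := Real.log_pos hz
  set Δ := (1 + 2 * (3 * x)) ^ (x ^ (1 - δ)) *
    (2 : ℝ) ^ ((2 + δ) * x / Real.log (x ^ (1 - δ))) with hΔ
  have hΔ0 : 0 < Δ := by positivity
  have hdiv : ∀ l ∈ Ioc y N, (l.divisors.card : ℝ) ≤ Δ := by
    intro l hl
    rw [mem_Ioc] at hl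
    refine (card_divisors_le_rpow hz (by omega) hl.2).trans ?_
    refine mul_le_mul ?_ ?_ (by positivity) (by positivity)
    · exact Real.rpow_le_rpow (by positivity) (by linarith) (by linarith)
    · refine Real.rpow_le_rpow_of_exponent_le one_le_two ?_
      gcongr
  have hAFE : ∀ (q : ℕ) [NeZero q] (χ : DirichletCharacter ℂ q), χ ≠ 1 → ∀ s : ℂ, s.re = 1 / 2 →
      ∀ M : ℕ, 1 ≤ M → 2 * ‖s‖ ≤ M →
        ‖DirichletCharacter.LFunction χ s -
          ∑ n ∈ range (q * M), χ (n : ZMod q) * (n : ℂ) ^ (-s)‖ ≤ A * √(q / M) :=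
    fun q _ χ hχ s hs M h1 h2 => (hAFE₁ q χ hχ s hs M h1 h2).trans
      (mul_le_mul_of_nonneg_right (le_max_left _ _) (Real.sqrt_nonneg _))
  have hmain := one_le_of_forall_LFunction_eq_zero hAFE hχ ha hab hK0 hKpi hM1
    (by exact_mod_cast hyr) hyM hdiv fun k hk => by
      rw [mem_Icc] at hk
      refine H k hk.1 ?_
      rw [hE]
      exact le_trans (by exact_mod_cast hk.2) hK1
  have hterm1 : 2 * √y * (A * √(q / M)) ≤ 1 / 4 := by
    have h1 : √(y : ℝ) * √(q / M) ≤ 32 / (b * e) := by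
      rw [← Real.sqrt_mul (by positivity)]
      refine Real.sqrt_le_iff.2 ⟨by positivity, ?_⟩
      rw [div_pow, ← mul_div_assoc, div_le_div_iff₀ hM0 (by positivity)]
      linarith
    have h2 : 32 / (b * e) ≤ 32 / e :=
      div_le_div_of_nonneg_left (by norm_num) he0 (le_mul_of_one_le_left he0.le hb)
    calc 2 * √y * (A * √(q / M)) = 2 * A * (√y * √(q / M)) := by ring
      _ ≤ 2 * A * (32 / e) := by gcongr; exact h1.trans h2
      _ = 64 * A / e := by ring
      _ ≤ 1 / 4 := by rw [div_le_iff₀ he0]; linarith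
  have hsum : (√(y : ℝ))⁻¹ + 13 * √(N : ℝ) / (K * b) ≤ 1100 / (b * e) := by
    have h1 : (√(y : ℝ))⁻¹ ≤ 2 / (b * e) := by
      rw [← inv_div]
      refine inv_anti₀ (by positivity) (Real.le_sqrt_of_sq_le ?_)
      have : (b * e / 2) ^ 2 = b ^ 2 * e ^ 2 / 4 := by ring
      linarith
    have h2 : √(N : ℝ) ≤ 80 * (K * b) / (b * e) := by
      refine Real.sqrt_le_iff.2 ⟨by positivity, ?_⟩
      rw [div_pow, le_div_iff₀ (by positivity), hNr]
      calc (y : ℝ) * q * M * (b * e) ^ 2 = (y * q * (b * e) ^ 2) * M := by ring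
        _ ≤ 1024 * (K * b) * (6 * (K * b)) := by gcongr
        _ = 6144 * (K * b) ^ 2 := by ring
        _ ≤ 6400 * (K * b) ^ 2 := by gcongr; norm_num
        _ = _ := by ring
    have h3 : 13 * √(N : ℝ) / (K * b) ≤ 1040 / (b * e) := by
      rw [div_le_iff₀ hKb0]
      calc 13 * √(N : ℝ) ≤ 13 * (80 * (K * b) / (b * e)) := by gcongr
        _ = _ := by ring
    calc _ ≤ 2 / (b * e) + 1040 / (b * e) := add_le_add h1 h3
      _ = 1042 / (b * e) := by ring
      _ ≤ _ := by gcongr; norm_num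
  -- The `b` turns of the phase per unit of `log l` cancel against the `b` in `1/(be)`, which is why
  -- `y` carries `b²`.
  have hterm2 : Δ * ((b * Real.log N + 1) * (2 * (1 + Real.log K)) *
      ((√(y : ℝ))⁻¹ + 13 * √(N : ℝ) / (K * b))) ≤ 1 / 4 := by
    have h1 : b * Real.log N ≤ b * (3 * x) := mul_le_mul_of_nonneg_left hlogN3 hb0.le
    calc _ ≤ Δ * ((b * (1 + 3 * x)) * (2 * (1 + 2 * x)) * (1100 / (b * e))) := by
          gcongr
          linarith
      _ = Δ * ((1 + 3 * x) * (2 * (1 + 2 * x)) * 1100) / e := by field_simp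
      _ ≤ 1 / 4 := by rw [div_le_iff₀ he0]; linarith
  linarith

lemma three_le_of_ne_one {q : ℕ} [NeZero q] {χ : DirichletCharacter ℂ q} (hχ : χ ≠ 1) : 3 ≤ q := by
  by_contra h
  refine hχ (MulChar.ext fun u => ?_)
  have h1 : q = 1 ∨ q = 2 := by have := NeZero.pos q; omega
  have : u = 1 := by
    rcases h1 with rfl | rfl
    · exact Subsingleton.elim _ _
    · revert u; decide
  simp [this]

lemma one_le_exp_div_log_log {D Q : ℝ} (hD : 0 ≤ D) (hQ : 3 ≤ Q) :
    1 ≤ Real.exp (D * Real.log Q / Real.log (Real.log Q)) := by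
  have h1 : 1 ≤ Real.log Q := by
    rw [Real.le_log_iff_exp_le (by linarith)]
    linarith [Real.exp_one_lt_d9]
  exact Real.one_le_exp (div_nonneg (mul_nonneg hD (by linarith)) (Real.log_nonneg h1))

theorem theorem2 (D : ℝ) (hD : 8 * Real.log 2 < D) :
    ∃ C : ℝ, 0 < C ∧
      ∀ (q : ℕ) [NeZero q] (χ : DirichletCharacter ℂ q), χ ≠ 1 →
        ∀ a b : ℝ, 0 ≤ a → a < b →
          (2 * Real.pi ≤ b →
            ∃ k : ℕ, 0 < k ∧
              (k : ℝ) ≤ C * (b ^ 3 * (q : ℝ) *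
                Real.exp (D * Real.log (b ^ 3 * (q : ℝ)) /
                  Real.log (Real.log (b ^ 3 * (q : ℝ))))) ∧
              DirichletCharacter.LFunction χ
                (1 / 2 + Complex.I * ((a + (k : ℝ) * b : ℝ) : ℂ)) ≠ 0) ∧
          (0 < b → b ≤ 2 * Real.pi →
            ∃ k : ℕ, 0 < k ∧
              (k : ℝ) ≤ C * (b⁻¹ * (q : ℝ) *
                Real.exp (D * Real.log (q : ℝ) / Real.log (Real.log (q : ℝ)))) ∧
              DirichletCharacter.LFunction χ
                (1 / 2 + Complex.I * ((a + (k : ℝ) * b : ℝ) : ℂ)) ≠ 0) := by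
  obtain ⟨R₀, hR₀, hmain⟩ := exists_LFunction_ne_zero_of_one_le hD
  have hD0 : 0 ≤ D := by linarith [Real.log_pos one_lt_two]
  set F : ℝ → ℝ := fun Q => Q * Real.exp (D * Real.log Q / Real.log (Real.log Q)) with hF
  -- Below the threshold, `F R₀` is a constant and `F Q ≥ 1`, so no monotonicity of `F` is needed.
  set C₁ := max (F R₀) 1 with hC₁
  have hC1 : 1 ≤ C₁ := le_max_right _ _
  have hmax : ∀ Q : ℝ, 3 ≤ Q → F (max Q R₀) ≤ C₁ * F Q := by
    intro Q hQ
    have h1 : 1 ≤ F Q := by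
      have := one_le_exp_div_log_log hD0 hQ
      simp only [hF]; nlinarith
    rcases le_total R₀ Q with h | h
    · rw [max_eq_left h]; nlinarith
    · rw [max_eq_right h]
      have : F R₀ ≤ C₁ := le_max_left _ _
      nlinarith
  refine ⟨8 * C₁, by linarith, fun q _ χ hχ a b ha hab => ⟨fun hb => ?_, fun hb0 hb => ?_⟩⟩
  all_goals
    have hq3 : (3 : ℝ) ≤ q := by exact_mod_cast three_le_of_ne_one hχ
  · have hb1 : 1 ≤ b := by linarith [Real.pi_gt_three]
    have hQ : 3 ≤ b ^ 3 * q := by nlinarith [one_le_pow₀ hb1 (n := 3)]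
    obtain ⟨k, hk0, hk, hL⟩ := hmain (max (b ^ 3 * q) R₀) (le_max_right _ _) q χ hχ a b ha hab hb1
      (by linarith [le_max_left (b ^ 3 * q) R₀])
    have hk' : (k : ℝ) ≤ C₁ * F (b ^ 3 * q) := le_trans hk (hmax _ hQ)
    refine ⟨k, hk0, ?_, hL⟩
    change (k : ℝ) ≤ 8 * C₁ * F (b ^ 3 * q)
    have : (0 : ℝ) ≤ k := by positivity
    linarith
  -- The sparser progression of step `lb` has `1 ≤ lb < 1 + b < 8`. Its index `k` corresponds to
  -- `kl` in the original one, which costs the factor `l ≤ 8/b`.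
  · set l := ⌈b⁻¹⌉₊ with hl
    have hbi : 0 < b⁻¹ := by positivity
    have hl0 : 0 < l := Nat.ceil_pos.2 hbi
    have hl1 : b⁻¹ ≤ l := Nat.le_ceil _
    have hl2 : (l : ℝ) < b⁻¹ + 1 := Nat.ceil_lt_add_one hbi.le
    have hpi := Real.pi_lt_d2
    have hbb : b⁻¹ * b = 1 := inv_mul_cancel₀ hb0.ne'
    have hlb1 : 1 ≤ l * b := by nlinarith
    have hlb2 : l * b ≤ 8 := by nlinarith
    have hab' : a < l * b := by
      have : (1 : ℝ) ≤ l := by exact_mod_cast hl0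
      nlinarith
    have hl8 : (l : ℝ) ≤ 8 * b⁻¹ := by
      have : 1 ≤ 7 * b⁻¹ := by nlinarith
      linarith
    obtain ⟨k, hk0, hk, hL⟩ := hmain (max q R₀) (le_max_right _ _) q χ hχ a (l * b) ha hab' hlb1
      (by
        have h1 : (l * b) ^ 3 ≤ 8 ^ 3 := pow_le_pow_left₀ (by linarith) hlb2 3
        have h2 := le_max_left (q : ℝ) R₀
        nlinarith)
    have hk' : (k : ℝ) ≤ C₁ * F q := le_trans hk (hmax _ hq3)
    refine ⟨k * l, Nat.mul_pos hk0 hl0, ?_, ?_⟩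
    · push_cast
      calc (k : ℝ) * l ≤ C₁ * F q * (8 * b⁻¹) := by gcongr
        _ = _ := by simp only [hF]; ring
    · convert! hL using 4
      push_cast; ring
end
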